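/- Let $n\ge 3$ and let $a=(a_1,\dots,a_n)$ be an $n$-tuple of positive integers. Call a tuple $(b_1,\dots,b_n)$ of nonnegative integers *prehomogeneous* if the natural action of $GL_{b_1}(\mathbb{C})\times\cdots\times GL_{b_n}(\mathbb{C})$ on $\mathbb{C}^{b_1}\otimes\cdots\otimes\mathbb{C}^{b_n}$ has a Zariski-dense orbit. Put $$N(b_1,\dots,b_n)=\sum_{i=1}^n(b_i^2-1)-\Bigl(\prod_{i=1}^n b_i-1\Bigr).$$ A *castling transform* of a tuple $(b_1,\dots,b_n)$ of nonnegative integers is a tuple of nonnegative integers of the form $$\Bigl(b_{\sigma(1)},\dots,b_{\sigma(n-1)},\ \prod_{i=1}^{n-1}b_{\sigma(i)}-b_{\sigma(n)}\Bigr),\qquad \sigma\in S_n;$$ *castling equivalence* is the equivalence relation on $n$-tuples of nonnegative integers generated by castling transforms. A tuple is *minimal* if its product $\prod_i b_i$ is positive and is the smallest positive product occurring in its castling-equivalence class. Then: 1. If $N(a)\le -1$, then $a$ is not prehomogeneous. 2. If $N(a)=0$ or $N(a)=1$, then $a$ is prehomogeneous. 3. If $N(a)=2$, then either $n\ge 4$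 and $a$ is castling-equivalent to a minimal $n$-tuple all of whose entries are at least $2$, or $a$ is castling-equivalent to a minimal $n$-tuple of the form $(1,\dots,1,2,k,k)$ for a unique integer $k\ge 1$. In the first case $a$ is prehomogeneous; in the second case $a$ is prehomogeneous if and only if $k\le 3$. 4. If $N(a)\ge 3$, then $a$ is prehomogeneous. Moreover, if $n=3$, then $N(a)\neq 1$. -/

import Mathlib

open scoped TensorProduct

namespace TensorCastling

/-- The algebra of polynomial functions on a complex vector space `V`: the algebra of functions
`V → ℂ` generated by the linear forms. -/
def polynomialFunctions (V : Type*) [AddCommGroup V] [Module ℂ V] : Subalgebra ℂ (V → ℂ) :=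
  Algebra.adjoin ℂ (Set.range fun φ : Module.Dual ℂ V => (fun v : V => φ v))

/-- The Zariski topology on a complex vector space `V`: it is generated by the principal open sets
`{v | f v ≠ 0}`, for `f` a polynomial function on `V`. -/
abbrev zariskiTopology (V : Type*) [AddCommGroup V] [Module ℂ V] : TopologicalSpace V :=
  TopologicalSpace.generateFrom {U : Set V | ∃ f ∈ polynomialFunctions V, U = {v | f v ≠ 0}}

/-- A representation `ρ` of `G` on `V` is prehomogeneous if it has an orbit that is dense for the
Zariski topology. -/
def IsPrehomogeneous {G V : Type*} [Group G] [AddCommGroup V] [Module ℂ V]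
    (ρ : Representation ℂ G V) : Prop :=
  ∃ v : V, @Dense V (zariskiTopology V) (Set.range fun g : G => ρ g v)

/-- The space `ℂ^{a₁} ⊗ ⋯ ⊗ ℂ^{aₙ}`. -/
abbrev TensorSpace {n : ℕ} (a : Fin n → ℕ) : Type :=
  ⨂[ℂ] i, (Fin (a i) → ℂ)

/-- The natural action of `GL_{a₁}(ℂ) × ⋯ × GL_{aₙ}(ℂ)` on `ℂ^{a₁} ⊗ ⋯ ⊗ ℂ^{aₙ}`, given on
decomposable tensors by `(g₁, …, gₙ) · (v₁ ⊗ ⋯ ⊗ vₙ) = g₁ v₁ ⊗ ⋯ ⊗ gₙ vₙ`. -/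
noncomputable def tensorRep {n : ℕ} (a : Fin n → ℕ) :
    Representation ℂ (∀ i, GL (Fin (a i)) ℂ) (TensorSpace a) where
  toFun g := PiTensorProduct.map fun i => Matrix.toLin' (g i : Matrix (Fin (a i)) (Fin (a i)) ℂ)
  map_one' := by
    simp only [Pi.one_apply, Units.val_one, Matrix.toLin'_one]
    exact PiTensorProduct.map_id
  map_mul' g h := by
    simp only [Pi.mul_apply, Units.val_mul, Matrix.toLin'_mul]
    exact PiTensorProduct.map_comp _ _

/-- The tuple `(a₁, …, aₙ)` is prehomogeneous if `ℂ^{a₁} ⊗ ⋯ ⊗ ℂ^{aₙ}` is prehomogeneous for the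
natural action of `GL_{a₁}(ℂ) × ⋯ × GL_{aₙ}(ℂ)`. -/
def IsPrehomogeneousTuple {n : ℕ} (a : Fin n → ℕ) : Prop :=
  IsPrehomogeneous (tensorRep a)

/-- `N(a₁, …, aₙ) = ∑ᵢ (aᵢ² - 1) - (∏ᵢ aᵢ - 1)`, an integer. -/
def tupleN {n : ℕ} (a : Fin n → ℕ) : ℤ :=
  ∑ i, ((a i : ℤ) ^ 2 - 1) - (∏ i, (a i : ℤ) - 1)

/-- `b` is a castling transform of `a`: for some permutation `σ`, one has
`b = (a_{σ(1)}, …, a_{σ(n-1)}, ∏_{i < n} a_{σ(i)} - a_{σ(n)})`, the last entry being nonnegative.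
The index of the last entry is the `i : Fin n` with `i + 1 = n`. -/
def IsCastlingTransform {n : ℕ} (a b : Fin n → ℕ) : Prop :=
  ∃ σ : Equiv.Perm (Fin n), ∀ i : Fin n,
    (i.val + 1 < n → b i = a (σ i)) ∧
    (i.val + 1 = n → b i + a (σ i) = ∏ j ∈ Finset.univ.erase i, a (σ j))

/-- Castling equivalence: the equivalence relation on tuples of nonnegative integers generated by
castling transformations. -/
def CastlingEquiv {n : ℕ} (a b : Fin n → ℕ) : Prop :=
  Relation.EqvGen IsCastlingTransform a b

/-- A tuple is minimal if its dimension `∏ᵢ aᵢ` is positive and is the smallest positive dimension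
occurring in its castling-equivalence class. -/
def IsMinimalTuple {n : ℕ} (a : Fin n → ℕ) : Prop :=
  0 < ∏ i, a i ∧ ∀ b : Fin n → ℕ, CastlingEquiv a b → 0 < ∏ i, b i → ∏ i, a i ≤ ∏ i, b i

/-- The `n`-tuple `(1, …, 1, 2, k, k)` (used for `n ≥ 3`). -/
def twoKK (n k : ℕ) : Fin n → ℕ :=
  fun i => if i.val + 3 < n then 1 else if i.val + 3 = n then 2 else k

end TensorCastling

/-! Castling preserves both sides of the question. View a tensor as a matrix whose columns are
indexed by one factor of dimension `m`. When the matrix has full column rank, its column space is an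
`m`-dimensional subspace of a space of dimension `P`, the product of the other entries. Passing to
the orthogonal complement exchanges `m` and `P - m`. The remaining group is closed under
transposition, so dense orbits correspond (`MatrixPrehomogeneous.castling`). As a function of `m`,
`N` is `m ^ 2 - P * m` plus a constant, so it is unchanged too.

On positive multisets at most one entry can be castled to a smaller positive value
(`CastlingDown.unique`). Reduction is therefore deterministic and ends at an irreducible multiset.
By `irreducible_trichotomy` there are three outcomes. If the largest entry is at least the product
of the others, the full-rank matrices contain a dense orbit, and `N` is 0, 2 or at least 3, with 2
only for `{2, 1, …, 1}` (`multisetN_dominant`). If the multiset is `{k, k, 2, 1, …, 1}`, then `N =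
2`, and the question is about pencils of `k × k` matrices. Their determinants are binary forms of
degree `k`, which have moduli exactly when `k ≥ 4`; for `k = 2, 3` a tangent space computation gives
an open orbit. Otherwise `N ≤ -1`, and a parameter count excludes a dense orbit
(`not_kronPrehomogeneous_of_lt`).

Hence `N = 1` never occurs for `n ≥ 3`. For `N = 2` the class always contains some `(1, …, 1, 2, k,
k)`; when `n ≥ 4` this normal form has an entry 1, so the alternative with all entries at least 2 is
empty. -/

namespace TensorCastling

/-! ### Polynomial maps and Zariski density -/

section PolyMap

variable {U V W : Type*} [AddCommGroup U] [Module ℂ U] [AddCommGroup V] [Module ℂ V]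
  [AddCommGroup W] [Module ℂ W]

/-- A map of complex vector spaces is polynomial if its composition with every linear form is a
polynomial function. -/
def PolyMap (Φ : V → W) : Prop :=
  ∀ φ : Module.Dual ℂ W, (fun v => φ (Φ v)) ∈ polynomialFunctions V

theorem polyMap_iff_mem {f : V → ℂ} : PolyMap f ↔ f ∈ polynomialFunctions V := by
  constructor
  · intro h
    exact h LinearMap.id
  · intro h φ
    have : (fun v => φ (f v)) = φ 1 • f := by
      funext v
      have := φ.map_smul (f v) 1
      simp only [smul_eq_mul, mul_one] at this
      simp [this, mul_comm]
    rw [this]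
    exact Subalgebra.smul_mem _ h _

theorem PolyMap.of_linear (L : V →ₗ[ℂ] W) : PolyMap (fun v => L v) := fun φ =>
  Algebra.subset_adjoin ⟨φ.comp L, rfl⟩

theorem PolyMap.const (c : W) : PolyMap (fun _ : V => c) := fun φ =>
  (polynomialFunctions V).algebraMap_mem (φ c)

theorem PolyMap.id : PolyMap (fun v : V => v) := PolyMap.of_linear LinearMap.id

theorem PolyMap.add {f g : V → W} (hf : PolyMap f) (hg : PolyMap g) :
    PolyMap (fun v => f v + g v) := fun φ => by
  simp only [map_add]
  exact (polynomialFunctions V).add_mem (hf φ) (hg φ)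

theorem PolyMap.neg {f : V → W} (hf : PolyMap f) : PolyMap (fun v => -f v) := fun φ => by
  simp only [map_neg]
  exact (polynomialFunctions V).neg_mem (hf φ)

theorem PolyMap.mul {f g : V → ℂ} (hf : PolyMap f) (hg : PolyMap g) :
    PolyMap (fun v => f v * g v) :=
  polyMap_iff_mem.2 ((polynomialFunctions V).mul_mem (polyMap_iff_mem.1 hf) (polyMap_iff_mem.1 hg))

theorem PolyMap.sum {ι : Type*} {s : Finset ι} {f : ι → V → W} (hf : ∀ i ∈ s, PolyMap (f i)) :
    PolyMap (fun v => ∑ i ∈ s, f i v) := fun φ => by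
  have := (polynomialFunctions V).sum_mem (fun i hi => hf i hi φ)
  convert this using 1
  funext v
  simp

theorem PolyMap.prod {ι : Type*} {s : Finset ι} {f : ι → V → ℂ} (hf : ∀ i ∈ s, PolyMap (f i)) :
    PolyMap (fun v => ∏ i ∈ s, f i v) := by
  rw [polyMap_iff_mem]
  have := (polynomialFunctions V).prod_mem (fun i hi => polyMap_iff_mem.1 (hf i hi))
  convert this using 1
  funext v
  simp

theorem PolyMap.comp {g : V → W} {f : U → V} (hg : PolyMap g) (hf : PolyMap f) :
    PolyMap (fun u => g (f u)) := by
  intro φ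
  have key : ∀ h ∈ polynomialFunctions V, (fun u => h (f u)) ∈ polynomialFunctions U := by
    intro h hh
    induction hh using Algebra.adjoin_induction with
    | mem x hx =>
      obtain ⟨ψ, rfl⟩ := hx
      exact hf ψ
    | algebraMap r => exact (polynomialFunctions U).algebraMap_mem r
    | add x y _ _ hx hy => exact (polynomialFunctions U).add_mem hx hy
    | mul x y _ _ hx hy => exact (polynomialFunctions U).mul_mem hx hy
  exact key _ (hg φ)

theorem PolyMap.pi {ι : Type*} [Finite ι] {E : ι → Type*} [∀ i, AddCommGroup (E i)]
    [∀ i, Module ℂ (E i)] {f : V → ∀ i, E i} (hf : ∀ i, PolyMap (fun v => f v i)) :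
    PolyMap f := by
  classical
  have := Fintype.ofFinite ι
  intro φ
  have h : (fun v => φ (f v)) = fun v => ∑ i, (φ.comp (LinearMap.single ℂ E i)) (f v i) := by
    funext v
    conv_lhs => rw [← Finset.univ_sum_single (f v)]
    simp
  rw [h]
  have := (polynomialFunctions V).sum_mem
    (fun i (_ : i ∈ Finset.univ) => hf i (φ.comp (LinearMap.single ℂ E i)))
  convert this using 1
  funext v
  simp

theorem PolyMap.apply {ι : Type*} {E : ι → Type*} [∀ i, AddCommGroup (E i)]
    [∀ i, Module ℂ (E i)] {f : V → ∀ i, E i} (hf : PolyMap f) (i : ι) :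
    PolyMap (fun v => f v i) :=
  PolyMap.comp (g := fun x : ∀ i, E i => x i) (PolyMap.of_linear (LinearMap.proj (R := ℂ) (φ := E) i)) hf

variable {l m n : Type*}

theorem PolyMap.matrix [Finite m] [Finite n] {f : V → Matrix m n ℂ}
    (hf : ∀ i j, PolyMap (fun v => f v i j)) : PolyMap f :=
  PolyMap.pi (E := fun _ : m => n → ℂ) fun i => PolyMap.pi fun j => hf i j

theorem PolyMap.entry {f : V → Matrix m n ℂ} (hf : PolyMap f) (i : m) (j : n) :
    PolyMap (fun v => f v i j) :=
  PolyMap.comp (g := fun X : Matrix m n ℂ => X i j)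
    (PolyMap.of_linear (Matrix.entryLinearMap ℂ ℂ i j)) hf

theorem PolyMap.matrix_mul [Finite l] [Fintype m] [Finite n] {f : V → Matrix l m ℂ}
    {g : V → Matrix m n ℂ} (hf : PolyMap f) (hg : PolyMap g) : PolyMap (fun v => f v * g v) :=
  PolyMap.matrix fun i j => by
    simp only [Matrix.mul_apply]
    exact PolyMap.sum fun k _ => (hf.entry i k).mul (hg.entry k j)

theorem PolyMap.det [Fintype m] [DecidableEq m] {f : V → Matrix m m ℂ} (hf : PolyMap f) :
    PolyMap (fun v => (f v).det) := by
  simp only [Matrix.det_apply']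
  exact PolyMap.sum fun σ _ => (PolyMap.const _).mul (PolyMap.prod fun i _ => hf.entry _ _)

theorem PolyMap.adjugate [Fintype m] [DecidableEq m] {f : V → Matrix m m ℂ} (hf : PolyMap f) :
    PolyMap (fun v => (f v).adjugate) :=
  PolyMap.matrix fun i j => by
    simp only [Matrix.adjugate_apply]
    refine PolyMap.det (PolyMap.matrix fun a b => ?_)
    by_cases h : a = j
    · subst h
      simpa using PolyMap.const _
    · simpa [Matrix.updateRow_ne h] using hf.entry a b

theorem PolyMap.exists_mvPolynomial {σ : Type*} [Finite σ] {f : (σ → ℂ) → ℂ} (hf : PolyMap f) :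
    ∃ p : MvPolynomial σ ℂ, ∀ x, f x = MvPolynomial.eval x p := by
  classical
  have := Fintype.ofFinite σ
  rw [polyMap_iff_mem] at hf
  induction hf using Algebra.adjoin_induction with
  | mem x hx =>
    obtain ⟨ψ, rfl⟩ := hx
    refine ⟨∑ i, MvPolynomial.C (ψ (Pi.single i 1)) * MvPolynomial.X i, fun x => ?_⟩
    simp only [map_sum, map_mul, MvPolynomial.eval_C, MvPolynomial.eval_X]
    conv_lhs => rw [LinearMap.pi_apply_eq_sum_univ ψ x]
    refine Finset.sum_congr rfl fun i _ => ?_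
    rw [smul_eq_mul, mul_comm]
    congr 2
    funext j
    simp [Pi.single_apply, eq_comm]
  | algebraMap r => exact ⟨MvPolynomial.C r, fun x => by simp⟩
  | add x y _ _ hx hy =>
    obtain ⟨p, hp⟩ := hx
    obtain ⟨q, hq⟩ := hy
    exact ⟨p + q, fun x => by simp [hp, hq]⟩
  | mul x y _ _ hx hy =>
    obtain ⟨p, hp⟩ := hx
    obtain ⟨q, hq⟩ := hy
    exact ⟨p * q, fun x => by simp [hp, hq]⟩

theorem PolyMap.of_mvPolynomial {σ : Type*} (p : MvPolynomial σ ℂ) :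
    PolyMap (fun x : σ → ℂ => MvPolynomial.eval x p) := by
  induction p using MvPolynomial.induction_on with
  | C a => simpa using PolyMap.const a
  | add p q hp hq => simpa using hp.add hq
  | mul_X p i hp => simpa using hp.mul (PolyMap.id.apply i)

/-- Polynomial functions on a finite-dimensional space have no zero divisors. -/
theorem PolyMap.eq_zero_of_mul_eq_zero [Module.Finite ℂ V] {f g : V → ℂ} (hf : PolyMap f)
    (hg : PolyMap g) (h : ∀ v, f v * g v = 0) : (∀ v, f v = 0) ∨ ∀ v, g v = 0 := by
  let e := (Module.finBasis ℂ V).equivFun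
  obtain ⟨p, hp⟩ := (hf.comp (PolyMap.of_linear e.symm.toLinearMap)).exists_mvPolynomial
  obtain ⟨q, hq⟩ := (hg.comp (PolyMap.of_linear e.symm.toLinearMap)).exists_mvPolynomial
  have hpq : p * q = 0 := by
    apply MvPolynomial.funext
    intro x
    rw [map_mul, ← hp, ← hq, h, map_zero]
  rcases mul_eq_zero.1 hpq with rfl | rfl
  · left
    intro v
    simpa using hp (e v)
  · right
    intro v
    simpa using hq (e v)

/-- A set is Zariski dense if every polynomial function vanishing on it is zero. -/
def ZDense (S : Set V) : Prop :=
  ∀ f : V → ℂ, PolyMap f → (∀ v ∈ S, f v = 0) → ∀ v, f v = 0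

theorem ZDense.mono {S T : Set V} (hS : ZDense S) (h : S ⊆ T) : ZDense T :=
  fun f hf hT => hS f hf fun v hv => hT v (h hv)

theorem ZDense.exists_ne {S : Set V} (hS : ZDense S) {f : V → ℂ} (hf : PolyMap f) {v : V}
    (hv : f v ≠ 0) : ∃ s ∈ S, f s ≠ 0 := by
  by_contra! h
  exact hv (hS f hf h v)

theorem zDense_ne_zero [Module.Finite ℂ V] {q : V → ℂ} (hq : PolyMap q) {v : V}
    (hv : q v ≠ 0) : ZDense {v | q v ≠ 0} := by
  intro f hf h
  refine (hf.eq_zero_of_mul_eq_zero hq fun w => ?_).resolve_right fun h0 => hv (h0 v)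
  by_cases hw : q w = 0
  · simp [hw]
  · simp [h w hw]

/-- Transfer of density along a family of polynomial maps that are jointly dominant, each of which
sends a dense set, away from a hypersurface, to the target set. -/
theorem ZDense.transfer [Module.Finite ℂ V] {S : Set V} (hS : ZDense S) {T : Set W} {κ : Sort*}
    (Φ : κ → V → W) (hΦ : ∀ k, PolyMap (Φ k)) {q : V → ℂ} (hq : PolyMap q) {v₀ : V}
    (hv₀ : q v₀ ≠ 0) (hT : ∀ k, ∀ x ∈ S, q x ≠ 0 → Φ k x ∈ T)
    (hdom : ZDense {w | ∃ k x, w = Φ k x}) : ZDense T := by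
  intro f hf h
  refine hdom f hf ?_
  rintro _ ⟨k, x, rfl⟩
  have hfk := hf.comp (hΦ k)
  refine (hfk.eq_zero_of_mul_eq_zero hq ?_).resolve_right (fun h0 => hv₀ (h0 v₀)) x
  refine hS _ (hfk.mul hq) fun v hv => ?_
  by_cases hw : q v = 0
  · simp [hw]
  · simp [h _ (hT k v hv hw)]

theorem ZDense.image {S : Set V} (hS : ZDense S) {Φ : V → W} (hΦ : PolyMap Φ)
    (hsurj : Function.Surjective Φ) : ZDense (Φ '' S) := by
  intro f hf h w
  obtain ⟨v, rfl⟩ := hsurj w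
  exact hS _ (hf.comp hΦ) (fun v hv => h _ ⟨v, hv, rfl⟩) v

/-- A polynomial map to a space of larger dimension satisfies a polynomial relation. -/
theorem exists_relation_of_card_lt {σ τ : Type} [Fintype σ] [Fintype τ]
    (hcard : Fintype.card σ < Fintype.card τ) {Φ : (σ → ℂ) → (τ → ℂ)} (hΦ : PolyMap Φ) :
    ∃ f : (τ → ℂ) → ℂ, PolyMap f ∧ (∃ y, f y ≠ 0) ∧ ∀ x, f (Φ x) = 0 := by
  choose p hp using fun t => (hΦ.apply t).exists_mvPolynomial
  -- The coordinates of `Φ` lie in a polynomial ring of transcendence degree `card σ`, which is too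
  -- small for `card τ` independent elements.
  have hdep : ¬ AlgebraicIndependent ℂ p := by
    intro h
    have h1 := h.cardinalMk_le_trdeg
    rw [MvPolynomial.trdeg_of_isDomain] at h1
    simp only [Cardinal.mk_fintype, Cardinal.lift_natCast, Nat.cast_le] at h1
    omega
  rw [algebraicIndependent_iff] at hdep
  push Not at hdep
  obtain ⟨P, hP, hP0⟩ := hdep
  refine ⟨fun y => MvPolynomial.eval y P, PolyMap.of_mvPolynomial P, ?_, fun x => ?_⟩
  · by_contra! h
    exact hP0 (MvPolynomial.funext fun y => by simpa using h y)
  · have : Φ x = fun t => MvPolynomial.eval x (p t) := funext fun t => hp t x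
    have h2 := congrArg (MvPolynomial.eval x) hP
    rw [map_zero, MvPolynomial.map_aeval] at h2
    rw [this, ← h2]
    have h3 : (MvPolynomial.eval x).comp (algebraMap ℂ (MvPolynomial σ ℂ)) = RingHom.id ℂ := by
      ext z
      simp
    rw [h3]
    rfl

/-- A finite union of images of polynomial maps from spaces of smaller dimension is not dense. -/
theorem not_zDense_of_card_lt {τ K : Type} [Fintype τ] [Finite K] {σ : K → Type}
    [∀ k, Fintype (σ k)] (hcard : ∀ k, Fintype.card (σ k) < Fintype.card τ)
    (Φ : ∀ k, (σ k → ℂ) → (τ → ℂ)) (hΦ : ∀ k, PolyMap (Φ k)) {S : Set (τ → ℂ)}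
    (hS : ∀ s ∈ S, ∃ k x, s = Φ k x) : ¬ ZDense S := by
  have := Fintype.ofFinite K
  intro h
  choose f hf hne hrel using fun k => exists_relation_of_card_lt (hcard k) (hΦ k)
  -- The product of the relations vanishes on the whole union, yet it is nonzero because there are
  -- no zero divisors.
  have hzero : ∀ y, ∏ k, f k y = 0 := by
    refine h _ (PolyMap.prod fun k _ => hf k) fun s hs => ?_
    obtain ⟨k, x, rfl⟩ := hS s hs
    exact Finset.prod_eq_zero (Finset.mem_univ k) (hrel k x)
  have key : ∀ s : Finset K, ∃ y, ∏ k ∈ s, f k y ≠ 0 := by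
    classical
    intro s
    induction s using Finset.induction_on with
    | empty => exact ⟨0, by simp⟩
    | insert a s ha ih =>
      by_contra! h0
      simp only [Finset.prod_insert ha] at h0
      rcases (hf a).eq_zero_of_mul_eq_zero (PolyMap.prod fun k _ => hf k) h0 with h1 | h1
      · exact (hne a).elim fun y hy => hy (h1 y)
      · exact ih.elim fun y hy => hy (h1 y)
  exact (key Finset.univ).elim fun y hy => hy (hzero y)

/-- Principal open sets are closed under intersection, since `f * g` is nonzero exactly where both
factors are. They thus form a basis, and density need only be tested on one polynomial at a time. -/
theorem dense_zariskiTopology_iff {S : Set V} :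
    @Dense V (zariskiTopology V) S ↔ ZDense S := by
  let _ := zariskiTopology V
  have hB : TopologicalSpace.IsTopologicalBasis
      {U : Set V | ∃ f ∈ polynomialFunctions V, U = {v | f v ≠ 0}} := by
    refine ⟨?_, ?_, rfl⟩
    · rintro _ ⟨f, hf, rfl⟩ _ ⟨g, hg, rfl⟩ x hx
      refine ⟨_, ⟨f * g, (polynomialFunctions V).mul_mem hf hg, rfl⟩, ?_, ?_⟩
      · exact mul_ne_zero hx.1 hx.2
      · intro y hy
        exact mul_ne_zero_iff.1 hy
    · refine Set.eq_univ_of_forall fun x => ⟨_, ⟨1, one_mem _, rfl⟩, ?_⟩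
      simp
  rw [hB.dense_iff]
  constructor
  · intro h f hf hS v
    by_contra hv
    obtain ⟨w, hw, hwS⟩ := h _ ⟨f, polyMap_iff_mem.1 hf, rfl⟩ ⟨v, hv⟩
    exact hw (hS w hwS)
  · rintro h _ ⟨f, hf, rfl⟩ ⟨v, hv⟩
    obtain ⟨s, hs, hs'⟩ := h.exists_ne (polyMap_iff_mem.2 hf) hv
    exact ⟨s, hs', hs⟩

end PolyMap

end TensorCastling

namespace TensorCastling

open Matrix

theorem exists_zDense_iff {V W : Type*} [AddCommGroup V] [Module ℂ V] [AddCommGroup W]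
    [Module ℂ W] (L : V ≃ₗ[ℂ] W) {O : V → Set V} {O' : W → Set W}
    (h : ∀ v w, w ∈ O v ↔ L w ∈ O' (L v)) :
    (∃ v, ZDense (O v)) ↔ ∃ w, ZDense (O' w) := by
  constructor
  · rintro ⟨v, hv⟩
    refine ⟨L v, (hv.image (PolyMap.of_linear L.toLinearMap) L.surjective).mono ?_⟩
    rintro _ ⟨w, hw, rfl⟩
    exact (h v w).1 hw
  · rintro ⟨w, hw⟩
    refine ⟨L.symm w,
      (hw.image (PolyMap.of_linear L.symm.toLinearMap) L.symm.surjective).mono ?_⟩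
    rintro _ ⟨x, hx, rfl⟩
    rw [h]
    simpa using hx

/-! ### Castling for spaces of matrices -/

section MatrixSpaces

variable {G : Type*} [Group G] {ι ι' κ κ' : Type} [Fintype ι] [DecidableEq ι] [Fintype ι']
  [DecidableEq ι'] [Fintype κ] [DecidableEq κ] [Fintype κ'] [DecidableEq κ']

/-- The orbit of a matrix `X` under left multiplication by the matrices of a representation `ρ` and
right multiplication by invertible matrices. -/
def matrixOrbit (ρ : G →* Matrix ι ι ℂ) (X : Matrix ι κ ℂ) : Set (Matrix ι κ ℂ) :=
  {Y | ∃ (g : G) (h : Matrix κ κ ℂ), h.det ≠ 0 ∧ Y = ρ g * X * h}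

/-- The space of matrices is prehomogeneous for the action of `G × GL(κ)`. -/
def MatrixPrehomogeneous (ρ : G →* Matrix ι ι ℂ) (κ : Type) [Fintype κ] [DecidableEq κ] : Prop :=
  ∃ X : Matrix ι κ ℂ, ZDense (matrixOrbit ρ X)

theorem map_inv_mul_map (ρ : G →* Matrix ι ι ℂ) (g : G) : ρ g⁻¹ * ρ g = 1 := by
  rw [← map_mul, inv_mul_cancel, map_one]

/-- This allows the base point of a dense orbit to be replaced by a generic point of that orbit. -/
theorem matrixOrbit_subset {ρ : G →* Matrix ι ι ℂ} {X Y : Matrix ι κ ℂ}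
    (h : Y ∈ matrixOrbit ρ X) : matrixOrbit ρ X ⊆ matrixOrbit ρ Y := by
  obtain ⟨g, k, hk, rfl⟩ := h
  rintro _ ⟨g', k', hk', rfl⟩
  have hku : IsUnit k.det := isUnit_iff_ne_zero.2 hk
  refine ⟨g' * g⁻¹, k⁻¹ * k', ?_, ?_⟩
  · rw [det_mul, det_nonsing_inv, Ring.inverse_eq_inv']
    exact mul_ne_zero (inv_ne_zero hk) hk'
  · have h1 : ρ g' * ρ g⁻¹ * (ρ g * X * k) * (k⁻¹ * k')
        = ρ g' * (ρ g⁻¹ * ρ g) * X * (k * k⁻¹) * k' := by simp only [Matrix.mul_assoc]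
    rw [map_mul, h1, map_inv_mul_map, mul_nonsing_inv _ hku, Matrix.mul_one, Matrix.mul_one]

theorem matrixPrehomogeneous_reindex (e : ι ≃ ι') (f : κ ≃ κ') (ρ : G →* Matrix ι ι ℂ) :
    MatrixPrehomogeneous ρ κ ↔
      MatrixPrehomogeneous
        (((reindexAlgEquiv ℂ ℂ e : Matrix ι ι ℂ →* Matrix ι' ι' ℂ)).comp ρ) κ' := by
  refine exists_zDense_iff (reindexLinearEquiv ℂ ℂ e f) fun v w => ?_
  constructor
  · rintro ⟨g, h, hh, rfl⟩
    refine ⟨g, reindex f f h, by simpa using hh, ?_⟩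
    simp [Matrix.submatrix_mul_equiv]
  · rintro ⟨g, h, hh, hw⟩
    refine ⟨g, reindex f.symm f.symm h, by simpa using hh, ?_⟩
    apply (reindexLinearEquiv ℂ ℂ e f).injective
    rw [hw]
    simp only [MonoidHom.coe_comp, MonoidHom.coe_coe, Function.comp_apply,
      coe_reindexAlgEquiv, coe_reindexLinearEquiv, reindex_apply]
    rw [← Matrix.submatrix_mul_equiv (ρ g * v) _ e.symm f.symm f.symm,
      ← Matrix.submatrix_mul_equiv (ρ g) v e.symm e.symm f.symm]
    congr 1
    simp [Matrix.submatrix_submatrix]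

/-- A basis of the orthogonal complement of the column space of `X`, depending polynomially
on `X`. -/
noncomputable def complementMatrix (X : Matrix (κ ⊕ κ') κ ℂ) : Matrix (κ ⊕ κ') κ' ℂ :=
  fromRows (-(X.toRows₂ * X.toRows₁.adjugate)ᵀ) (X.toRows₁.det • (1 : Matrix κ' κ' ℂ))

theorem polyMap_complementMatrix :
    PolyMap (complementMatrix : Matrix (κ ⊕ κ') κ ℂ → Matrix (κ ⊕ κ') κ' ℂ) := by
  have h1 : PolyMap (fun X : Matrix (κ ⊕ κ') κ ℂ => X.toRows₁) :=
    PolyMap.matrix fun i j => PolyMap.id.entry _ _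
  have h2 : PolyMap (fun X : Matrix (κ ⊕ κ') κ ℂ => X.toRows₂) :=
    PolyMap.matrix fun i j => PolyMap.id.entry _ _
  refine PolyMap.matrix fun i j => ?_
  rcases i with i | i
  · simpa [complementMatrix, -transpose_mul] using ((h2.matrix_mul h1.adjugate).entry j i).neg
  · simpa [complementMatrix] using h1.det.mul (PolyMap.const _)

theorem transpose_mul_eq (Z : Matrix (κ ⊕ κ') κ' ℂ) (X : Matrix (κ ⊕ κ') κ ℂ) :
    Zᵀ * X = Z.toRows₁ᵀ * X.toRows₁ + Z.toRows₂ᵀ * X.toRows₂ := by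
  conv_lhs => rw [← fromRows_toRows Z, ← fromRows_toRows X, transpose_fromRows,
    fromCols_mul_fromRows]

theorem complementMatrix_transpose_mul (X : Matrix (κ ⊕ κ') κ ℂ) :
    (complementMatrix X)ᵀ * X = 0 := by
  rw [transpose_mul_eq, complementMatrix, toRows₁_fromRows, toRows₂_fromRows]
  rw [transpose_neg, transpose_transpose, Matrix.neg_mul, Matrix.mul_assoc, adjugate_mul]
  simp

theorem complementMatrix_mulVec_injective {X : Matrix (κ ⊕ κ') κ ℂ} (hX : X.toRows₁.det ≠ 0)
    {u : κ' → ℂ} (h : complementMatrix X *ᵥ u = 0) : u = 0 := by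
  rw [complementMatrix, fromRows_mulVec] at h
  funext i
  have := congrFun h (Sum.inr i)
  simpa [hX, smul_mulVec] using this

/-- The bottom block of `Z` determines its top block through `Zᵀ * X = 0`. Multiplying by the
determinant replaces the inverse of the top block of `X` by its adjugate, so everything stays
polynomial. -/
theorem eq_complementMatrix_mul {X : Matrix (κ ⊕ κ') κ ℂ} {Z : Matrix (κ ⊕ κ') κ' ℂ} (hZ : Zᵀ * X = 0) :
    X.toRows₁.det • Z = complementMatrix X * Z.toRows₂ := by
  have h1 : Z.toRows₁ᵀ * X.toRows₁ = -(Z.toRows₂ᵀ * X.toRows₂) := by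
    rw [transpose_mul_eq] at hZ
    exact eq_neg_of_add_eq_zero_left hZ
  have h2 : X.toRows₁.det • Z.toRows₁ᵀ = -(Z.toRows₂ᵀ * (X.toRows₂ * X.toRows₁.adjugate)) := by
    have := congrArg (· * X.toRows₁.adjugate) h1
    simpa [Matrix.mul_assoc, mul_adjugate] using this
  have h3 := congrArg transpose h2
  simp only [transpose_smul, transpose_transpose, transpose_neg, transpose_mul] at h3
  rw [complementMatrix, fromRows_mul]
  ext (i | i) j
  · have := congrFun (congrFun h3 i) j
    simpa [toRows₁] using this
  · simp [toRows₂]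

/-- If `g` moves a subspace, the inverse transpose of `g` moves its orthogonal complement; `hρ` puts
that matrix in the image of `ρ`. The polynomial maps `Y ↦ complementMatrix Y * h`, with `h`
invertible, then carry a dense orbit to a dense subset of one orbit. -/
theorem MatrixPrehomogeneous.castling_sum {ρ : G →* Matrix (κ ⊕ κ') (κ ⊕ κ') ℂ}
    (hρ : ∀ g, ∃ g', ρ g' = (ρ g)ᵀ) (h : MatrixPrehomogeneous ρ κ) :
    MatrixPrehomogeneous ρ κ' := by
  obtain ⟨X₀, hX₀⟩ := h
  have hq : PolyMap (fun X : Matrix (κ ⊕ κ') κ ℂ => X.toRows₁.det) :=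
    PolyMap.det (PolyMap.matrix fun i j => PolyMap.id.entry _ _)
  have hq0 : (fromRows (1 : Matrix κ κ ℂ) (0 : Matrix κ' κ ℂ)).toRows₁.det ≠ 0 := by
    rw [toRows₁_fromRows, det_one]
    exact one_ne_zero
  -- The base point is moved to where the top block is invertible, so that `complementMatrix` has
  -- full rank there.
  obtain ⟨X, hXmem, hX⟩ := hX₀.exists_ne hq hq0
  replace hX₀ := hX₀.mono (matrixOrbit_subset hXmem)
  refine ⟨complementMatrix X, ?_⟩
  refine hX₀.transfer (κ := {h : Matrix κ' κ' ℂ // h.det ≠ 0})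
    (fun h Y => complementMatrix Y * h.1)
    (fun h => polyMap_complementMatrix.matrix_mul (PolyMap.const _)) hq hq0 ?_ ?_
  · rintro ⟨h, hh⟩ _ ⟨g, k, hk, rfl⟩ hY
    obtain ⟨g', hg'⟩ := hρ g⁻¹
    refine ⟨g', ?_⟩
    set Y := ρ g * X * k with hYdef
    set Z := ρ g' * complementMatrix X with hZdef
    have hZY : Zᵀ * Y = 0 := by
      rw [hZdef, hYdef, hg', transpose_mul, transpose_transpose]
      have h1 : (complementMatrix X)ᵀ * ρ g⁻¹ * (ρ g * X * k)
          = (complementMatrix X)ᵀ * (ρ g⁻¹ * ρ g) * X * k := by simp only [Matrix.mul_assoc]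
      rw [h1, map_inv_mul_map, Matrix.mul_one, complementMatrix_transpose_mul, Matrix.zero_mul]
    have hZ := eq_complementMatrix_mul hZY
    -- A kernel vector of the bottom block would kill all of `Z`, by `hZ`, contradicting the
    -- injectivity of `complementMatrix X`.
    have hZ2 : IsUnit Z.toRows₂.det := by
      rw [isUnit_iff_ne_zero]
      intro h0
      obtain ⟨u, hu, hu0⟩ := exists_mulVec_eq_zero_iff.2 h0
      apply hu
      have h1 : Z *ᵥ u = 0 := by
        have h2 : Y.toRows₁.det • (Z *ᵥ u) = 0 := by
          rw [← smul_mulVec, hZ, ← mulVec_mulVec, hu0, mulVec_zero]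
        exact (smul_eq_zero.1 h2).resolve_left hY
      apply complementMatrix_mulVec_injective hX
      rw [hZdef, ← mulVec_mulVec] at h1
      have h2 := congrArg (ρ g'⁻¹ *ᵥ ·) h1
      simpa [mulVec_mulVec, ← Matrix.mul_assoc, map_inv_mul_map] using h2
    refine ⟨Y.toRows₁.det • (Z.toRows₂⁻¹ * h), ?_, ?_⟩
    · rw [det_smul, det_mul, det_nonsing_inv, Ring.inverse_eq_inv']
      exact mul_ne_zero (pow_ne_zero _ hY) (mul_ne_zero (inv_ne_zero hZ2.ne_zero) hh)
    · rw [Matrix.mul_smul, ← Matrix.smul_mul, hZ, Matrix.mul_assoc, ← Matrix.mul_assoc _ _ h,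
        mul_nonsing_inv _ hZ2, Matrix.one_mul]
  · have hp : PolyMap (fun Y : Matrix (κ ⊕ κ') κ' ℂ => Y.toRows₂.det) :=
      PolyMap.det (PolyMap.matrix fun i j => PolyMap.id.entry _ _)
    have hp0 : (fromRows (0 : Matrix κ κ' ℂ) (1 : Matrix κ' κ' ℂ)).toRows₂.det ≠ 0 := by
      rw [toRows₂_fromRows, det_one]
      exact one_ne_zero
    refine (zDense_ne_zero hp hp0).mono fun Y (hY : Y.toRows₂.det ≠ 0) => ?_
    -- With top block 1 the complement is `(Y₁ * Y₂⁻¹; 1)`, and multiplying by `Y₂` on the right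
    -- recovers `Y`.
    refine ⟨⟨Y.toRows₂, hY⟩, fromRows 1 (-(Y.toRows₁ * Y.toRows₂⁻¹)ᵀ), ?_⟩
    have hu : IsUnit Y.toRows₂.det := isUnit_iff_ne_zero.2 hY
    conv_lhs => rw [← fromRows_toRows Y]
    rw [complementMatrix, toRows₁_fromRows, toRows₂_fromRows, fromRows_mul]
    simp only [adjugate_one, Matrix.mul_one, det_one, one_smul, Matrix.one_mul, transpose_neg,
      transpose_transpose, neg_neg]
    rw [Matrix.mul_assoc, nonsing_inv_mul _ hu, Matrix.mul_one]

/-- Castling: the spaces of `(m + m') × m` and `(m + m') × m'` matrices are prehomogeneous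
simultaneously. -/
theorem MatrixPrehomogeneous.castling {ρ : G →* Matrix ι ι ℂ} (hρ : ∀ g, ∃ g', ρ g' = (ρ g)ᵀ)
    (hcard : Fintype.card κ + Fintype.card κ' = Fintype.card ι) (h : MatrixPrehomogeneous ρ κ) :
    MatrixPrehomogeneous ρ κ' := by
  have e : ι ≃ κ ⊕ κ' := Fintype.equivOfCardEq (by simp [hcard])
  rw [matrixPrehomogeneous_reindex e (Equiv.refl _)] at h ⊢
  refine h.castling_sum fun g => ?_
  obtain ⟨g', hg'⟩ := hρ g
  exact ⟨g', by simp [hg']⟩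

/-- Right multiplication alone suffices: `h ↦ E * h` is onto for a coordinate embedding `E`, and
invertible `h` are dense. -/
theorem matrixPrehomogeneous_of_card_le (ρ : G →* Matrix ι ι ℂ)
    (hcard : Fintype.card ι ≤ Fintype.card κ) : MatrixPrehomogeneous ρ κ := by
  obtain ⟨i⟩ := Function.Embedding.nonempty_of_card_le hcard
  let E : Matrix ι κ ℂ := Matrix.of fun a b => if b = i a then 1 else 0
  have hE : ∀ (h : Matrix κ κ ℂ) a b, (E * h) a b = h (i a) b := by
    intro h a b
    simp [E, Matrix.mul_apply]
  refine ⟨E, ?_⟩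
  have hdet : PolyMap (fun h : Matrix κ κ ℂ => h.det) := PolyMap.id.det
  refine (zDense_ne_zero hdet (v := 1) (by simp)).transfer (κ := Unit)
    (fun _ h => E * h) (fun _ => (PolyMap.const _).matrix_mul PolyMap.id) (PolyMap.const (1 : ℂ))
    (v₀ := 0) one_ne_zero ?_ ?_
  · rintro - h hh -
    exact ⟨1, h, hh, by simp⟩
  · intro f _ h0 Y
    refine h0 Y ⟨(), Matrix.of fun b c => if hb : ∃ a, i a = b then Y hb.choose c else 0, ?_⟩
    ext a c
    have hex : ∃ a', i a' = i a := ⟨a, rfl⟩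
    rw [hE, Matrix.of_apply, dif_pos hex, i.injective hex.choose_spec]

end MatrixSpaces

/-! ### Tensors in coordinates and the separation of one factor -/

section Kronecker

variable {J J' : Type} [Fintype J] [DecidableEq J] [Fintype J'] [DecidableEq J']

/-- The Kronecker product of a family of square matrices. -/
def kron {a : J → ℕ} (g : ∀ j, Matrix (Fin (a j)) (Fin (a j)) ℂ) :
    Matrix (∀ j, Fin (a j)) (∀ j, Fin (a j)) ℂ :=
  Matrix.of fun r c => ∏ j, g j (r j) (c j)

theorem kron_mul {a : J → ℕ} (g h : ∀ j, Matrix (Fin (a j)) (Fin (a j)) ℂ) :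
    kron (fun j => g j * h j) = kron g * kron h := by
  ext r c
  simp only [kron, Matrix.of_apply, Matrix.mul_apply, ← Finset.prod_mul_distrib]
  rw [Finset.prod_univ_sum, Fintype.piFinset_univ]

theorem kron_one {a : J → ℕ} :
    kron (fun j => (1 : Matrix (Fin (a j)) (Fin (a j)) ℂ)) = 1 := by
  ext r c
  simp only [kron, Matrix.of_apply, Matrix.one_apply, Fintype.prod_ite_zero, ← funext_iff]
  simp

/-- The Kronecker product as a representation of a product of general linear groups. -/
def kronHom (a : J → ℕ) :
    (∀ j, GL (Fin (a j)) ℂ) →* Matrix (∀ j, Fin (a j)) (∀ j, Fin (a j)) ℂ where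
  toFun g := kron fun j => (g j).1
  map_one' := kron_one
  map_mul' _ _ := kron_mul _ _

theorem exists_kronHom_eq_transpose {a : J → ℕ} (g : ∀ j, GL (Fin (a j)) ℂ) :
    ∃ g', kronHom a g' = (kronHom a g)ᵀ := by
  refine ⟨fun j => GeneralLinearGroup.mkOfDetNeZero ((g j).1)ᵀ ?_, rfl⟩
  rw [det_transpose]
  exact (isUnits_det_units (g j)).ne_zero

/-- The orbit of a tensor, in coordinates. -/
def kronOrbit (a : J → ℕ) (v : (∀ j, Fin (a j)) → ℂ) : Set ((∀ j, Fin (a j)) → ℂ) :=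
  {w | ∃ g : ∀ j, GL (Fin (a j)) ℂ, w = kronHom a g *ᵥ v}

/-- Prehomogeneity of a family of positive integers, in coordinates. -/
def KronPrehomogeneous (a : J → ℕ) : Prop :=
  ∃ v, ZDense (kronOrbit a v)

theorem isPrehomogeneousTuple_iff {n : ℕ} (a : Fin n → ℕ) :
    IsPrehomogeneousTuple a ↔ KronPrehomogeneous a := by
  let T := (Basis.piTensorProduct fun i => Pi.basisFun ℂ (Fin (a i))).equivFun
  have hT : ∀ g x, T (tensorRep a g x) = kronHom a g *ᵥ T x := by
    intro g x
    have : T.toLinearMap ∘ₗ (tensorRep a g) = (Matrix.mulVecLin (kronHom a g)) ∘ₗ T.toLinearMap := by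
      refine PiTensorProduct.ext (MultilinearMap.ext fun y => ?_)
      funext r
      simp only [LinearMap.compMultilinearMap_apply, LinearMap.comp_apply]
      have h1 : ∀ z : ∀ i, Fin (a i) → ℂ, T (PiTensorProduct.tprod ℂ z) =
          fun r => ∏ i, z i (r i) := by
        intro z
        funext r
        simp [T]
      have h2 : tensorRep a g (PiTensorProduct.tprod ℂ y) =
          PiTensorProduct.tprod ℂ fun i => (g i).1 *ᵥ y i := by
        simp [tensorRep, PiTensorProduct.map_tprod]
      simp only [LinearEquiv.coe_coe, h1, h2, mulVecLin_apply]
      simp only [mulVec, dotProduct, kronHom, kron, MonoidHom.coe_mk, OneHom.coe_mk,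
        Matrix.of_apply, ← Finset.prod_mul_distrib]
      rw [Finset.prod_univ_sum, Fintype.piFinset_univ]
    exact LinearMap.congr_fun this x
  unfold IsPrehomogeneousTuple IsPrehomogeneous KronPrehomogeneous
  simp only [dense_zariskiTopology_iff]
  refine exists_zDense_iff T fun v w => ?_
  constructor
  · rintro ⟨g, rfl⟩
    exact ⟨g, hT g v⟩
  · rintro ⟨g, hg⟩
    exact ⟨g, T.injective ((hT g v).trans hg.symm)⟩

theorem KronPrehomogeneous.comp_equiv {a : J' → ℕ} (h : KronPrehomogeneous a) (e : J ≃ J') :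
    KronPrehomogeneous fun j => a (e j) := by
  obtain ⟨v, hv⟩ := h
  let E : (∀ j, Fin (a (e j))) ≃ ∀ j, Fin (a j) := Equiv.piCongrLeft (fun j => Fin (a j)) e
  have hE : ∀ r j, E r (e j) = r j := fun r j => Equiv.piCongrLeft_apply_apply _ _ _ _
  let L := LinearEquiv.funCongrLeft ℂ ℂ E
  refine ⟨L v, (hv.image (PolyMap.of_linear L.toLinearMap) L.surjective).mono ?_⟩
  rintro _ ⟨_, ⟨g, rfl⟩, rfl⟩
  refine ⟨fun j => g (e j), ?_⟩
  funext r
  simp only [LinearEquiv.coe_coe, L, LinearEquiv.funCongrLeft_apply, LinearMap.funLeft_apply,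
    mulVec, dotProduct]
  rw [← E.sum_comp]
  refine Finset.sum_congr rfl fun c _ => ?_
  congr 1
  simp only [kronHom, kron, MonoidHom.coe_mk, OneHom.coe_mk, Matrix.of_apply]
  rw [← e.prod_comp]
  simp only [hE]

/-- Flattening a tensor along the factor `none` gives a matrix: the other factors act on its rows by
their Kronecker product, the separated one acts on its columns by the transpose. -/
theorem kronPrehomogeneous_option (b : Option J → ℕ) :
    KronPrehomogeneous b ↔
      MatrixPrehomogeneous (kronHom fun j => b (some j)) (Fin (b none)) := by
  let E : (∀ j, Fin (b (some j))) × Fin (b none) ≃ ∀ o, Fin (b o) :=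
    (Equiv.prodComm _ _).trans (Equiv.piOptionEquivProd (β := fun o => Fin (b o))).symm
  have hEn : ∀ p, E p none = p.2 := fun p => rfl
  have hEs : ∀ p j, E p (some j) = p.1 j := fun p j => rfl
  let L : ((∀ o, Fin (b o)) → ℂ) ≃ₗ[ℂ] Matrix (∀ j, Fin (b (some j))) (Fin (b none)) ℂ :=
    (LinearEquiv.funCongrLeft ℂ ℂ E).trans (LinearEquiv.curry ℂ ℂ _ _)
  have hL : ∀ w r c, L w r c = w (E (r, c)) := fun w r c => rfl
  have key : ∀ (g : ∀ o, GL (Fin (b o)) ℂ) v,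
      L (kronHom _ g *ᵥ v) = kronHom _ (fun j => g (some j)) * L v * ((g none).1)ᵀ := by
    intro g v
    ext r c
    rw [hL]
    simp only [mulVec, dotProduct, Matrix.mul_apply, hL, Finset.sum_mul]
    rw [← E.sum_comp, Fintype.sum_prod_type, Finset.sum_comm]
    refine Finset.sum_congr rfl fun y _ => Finset.sum_congr rfl fun x _ => ?_
    simp only [kronHom, kron, MonoidHom.coe_mk, OneHom.coe_mk, Matrix.of_apply,
      Fintype.prod_option, hEn, hEs, transpose_apply]
    ring
  refine exists_zDense_iff L fun v w => ?_
  constructor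
  · rintro ⟨g, rfl⟩
    refine ⟨fun j => g (some j), ((g none).1)ᵀ, ?_, key g v⟩
    rw [det_transpose]
    exact (isUnits_det_units (g none)).ne_zero
  · rintro ⟨g, h, hh, hw⟩
    let g' : ∀ o, GL (Fin (b o)) ℂ := fun o =>
      match o with
      | none => GeneralLinearGroup.mkOfDetNeZero hᵀ (by rwa [det_transpose])
      | some j => g j
    exact ⟨g', L.injective (hw.trans (key g' v).symm)⟩

theorem kronPrehomogeneous_option_elim (a : J → ℕ) (m : ℕ) :
    KronPrehomogeneous (fun o : Option J => o.elim m a) ↔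
      MatrixPrehomogeneous (kronHom a) (Fin m) :=
  kronPrehomogeneous_option _

theorem KronPrehomogeneous.castling_option {a : J → ℕ} {m m' : ℕ} (hm : m + m' = ∏ j, a j)
    (h : KronPrehomogeneous (fun o : Option J => o.elim m a)) :
    KronPrehomogeneous (fun o : Option J => o.elim m' a) := by
  rw [kronPrehomogeneous_option_elim] at h ⊢
  exact h.castling exists_kronHom_eq_transpose (by simpa using hm)

theorem kronPrehomogeneous_option_of_le {a : J → ℕ} {m : ℕ} (hm : ∏ j, a j ≤ m) :
    KronPrehomogeneous (fun o : Option J => o.elim m a) := by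
  rw [kronPrehomogeneous_option_elim]
  exact matrixPrehomogeneous_of_card_le _ (by simpa using hm)

/-- One factor absorbs the scalar. This makes the action of an extra `GL₁` redundant. -/
theorem exists_kronHom_eq_smul [Nonempty J] {a : J → ℕ} (g : ∀ j, GL (Fin (a j)) ℂ) {c : ℂ}
    (hc : c ≠ 0) : ∃ g', kronHom a g' = c • kronHom a g := by
  obtain ⟨j₀⟩ := ‹Nonempty J›
  have hdet : (c • (g j₀).1).det ≠ 0 := by
    rw [det_smul]
    exact mul_ne_zero (pow_ne_zero _ hc) (isUnits_det_units (g j₀)).ne_zero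
  refine ⟨Function.update g j₀ (GeneralLinearGroup.mkOfDetNeZero _ hdet), ?_⟩
  ext r s
  simp only [kronHom, kron, MonoidHom.coe_mk, OneHom.coe_mk, Matrix.of_apply, Matrix.smul_apply]
  rw [← Finset.mul_prod_erase _ _ (Finset.mem_univ j₀),
    ← Finset.mul_prod_erase _ _ (Finset.mem_univ j₀), smul_eq_mul, ← mul_assoc]
  congr 1
  · rw [Function.update_self]
    rfl
  · refine Finset.prod_congr rfl fun j hj => ?_
    rw [Function.update_of_ne (Finset.ne_of_mem_erase hj)]

/-- Factors of dimension one do not affect prehomogeneity. -/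
theorem kronPrehomogeneous_option_one [Nonempty J] (a : J → ℕ) :
    KronPrehomogeneous (fun o : Option J => o.elim 1 a) ↔ KronPrehomogeneous a := by
  rw [kronPrehomogeneous_option_elim]
  let L : Matrix (∀ j, Fin (a j)) (Fin 1) ℂ ≃ₗ[ℂ] ((∀ j, Fin (a j)) → ℂ) :=
    LinearEquiv.ofBijective
      { toFun := fun X r => X r 0, map_add' := fun _ _ => rfl, map_smul' := fun _ _ => rfl }
      ⟨fun X Y h => by
        ext r c
        rw [Subsingleton.elim c 0]
        exact congrFun h r, fun v => ⟨Matrix.of fun r _ => v r, rfl⟩⟩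
  have key : ∀ g (h : Matrix (Fin 1) (Fin 1) ℂ) X,
      L (kronHom a g * X * h) = (h 0 0 • kronHom a g) *ᵥ L X := by
    intro g h X
    funext r
    change (kronHom a g * X * h) r 0 = ((h 0 0 • kronHom a g) *ᵥ fun r => X r 0) r
    rw [smul_mulVec]
    simp [Matrix.mul_apply, mulVec, dotProduct, mul_comm]
  refine exists_zDense_iff L fun v w => ?_
  constructor
  · rintro ⟨g, h, hh, rfl⟩
    obtain ⟨g', hg'⟩ := exists_kronHom_eq_smul g (c := h 0 0) (by simpa using hh)
    refine ⟨g', ?_⟩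
    rw [hg']
    exact key g h v
  · rintro ⟨g, hg⟩
    refine ⟨g, 1, by simp, L.injective ?_⟩
    rw [hg]
    refine Eq.trans ?_ (key g 1 v).symm
    simp

/-- Trilinear prehomogeneity in terms of tuples of matrices. -/
theorem kronPrehomogeneous_fin_three (a : Fin 3 → ℕ) :
    KronPrehomogeneous a ↔ ∃ V : Fin (a 0) → Matrix (Fin (a 1)) (Fin (a 2)) ℂ,
      ZDense {W | ∃ (x : Matrix (Fin (a 0)) (Fin (a 0)) ℂ) (y : Matrix (Fin (a 1)) (Fin (a 1)) ℂ)
        (z : Matrix (Fin (a 2)) (Fin (a 2)) ℂ), x.det ≠ 0 ∧ y.det ≠ 0 ∧ z.det ≠ 0 ∧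
          W = fun s => y * (∑ t, x s t • V t) * z} := by
  let E : Fin (a 0) × Fin (a 1) × Fin (a 2) ≃ ∀ i, Fin (a i) :=
    { toFun := fun p i => match i with
        | 0 => p.1
        | 1 => p.2.1
        | 2 => p.2.2
      invFun := fun r => (r 0, r 1, r 2)
      left_inv := fun p => rfl
      right_inv := fun r => by
        funext i
        fin_cases i <;> rfl }
  have hE0 : ∀ p, E p 0 = p.1 := fun p => rfl
  have hE1 : ∀ p, E p 1 = p.2.1 := fun p => rfl
  have hE2 : ∀ p, E p 2 = p.2.2 := fun p => rfl
  let L : ((∀ i, Fin (a i)) → ℂ) ≃ₗ[ℂ] (Fin (a 0) → Matrix (Fin (a 1)) (Fin (a 2)) ℂ) :=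
    (LinearEquiv.funCongrLeft ℂ ℂ E).trans ((LinearEquiv.curry ℂ ℂ _ _).trans
      (LinearEquiv.piCongrRight fun _ => LinearEquiv.curry ℂ ℂ _ _))
  have hL : ∀ w s r c, L w s r c = w (E (s, r, c)) := fun w s r c => rfl
  have key : ∀ (g : ∀ i, GL (Fin (a i)) ℂ) v, L (kronHom a g *ᵥ v) =
      fun s => (g 1).1 * (∑ t, (g 0).1 s t • L v t) * ((g 2).1)ᵀ := by
    intro g v
    funext s
    ext r c
    rw [hL]
    simp only [mulVec, dotProduct, Matrix.mul_apply, hL, Matrix.sum_apply, Matrix.smul_apply,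
      transpose_apply, Finset.sum_mul, Finset.mul_sum]
    rw [← E.sum_comp, Fintype.sum_prod_type, Finset.sum_congr rfl fun t _ =>
      (Fintype.sum_prod_type _).trans Finset.sum_comm, Finset.sum_comm]
    refine Finset.sum_congr rfl fun c' _ => ?_
    rw [Finset.sum_comm]
    refine Finset.sum_congr rfl fun r' _ => Finset.sum_congr rfl fun t _ => ?_
    simp only [kronHom, kron, MonoidHom.coe_mk, OneHom.coe_mk, Matrix.of_apply,
      Fin.prod_univ_three, hE0, hE1, hE2, smul_eq_mul]
    ring
  refine exists_zDense_iff L fun v w => ?_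
  constructor
  · rintro ⟨g, rfl⟩
    refine ⟨(g 0).1, (g 1).1, ((g 2).1)ᵀ, (isUnits_det_units (g 0)).ne_zero,
      (isUnits_det_units (g 1)).ne_zero, ?_, key g v⟩
    rw [det_transpose]
    exact (isUnits_det_units (g 2)).ne_zero
  · rintro ⟨x, y, z, hx, hy, hz, hw⟩
    let g : ∀ i, GL (Fin (a i)) ℂ := fun i => match i with
      | 0 => GeneralLinearGroup.mkOfDetNeZero x hx
      | 1 => GeneralLinearGroup.mkOfDetNeZero y hy
      | 2 => GeneralLinearGroup.mkOfDetNeZero zᵀ (by rwa [det_transpose])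
    exact ⟨g, L.injective (hw.trans (key g v).symm)⟩

end Kronecker

end TensorCastling

namespace TensorCastling

open Matrix

/-! ### The dimension bound for orbits -/

section Dimension

variable {J : Type} [Fintype J] [DecidableEq J]

theorem kron_smul {a : J → ℕ} (d : J → ℂ) (g : ∀ j, Matrix (Fin (a j)) (Fin (a j)) ℂ) :
    kron (fun j => d j • g j) = (∏ j, d j) • kron g := by
  ext r c
  simp [kron, Finset.prod_mul_distrib]

theorem exists_entry_ne_zero {m : ℕ} (hm : 1 ≤ m) (g : GL (Fin m) ℂ) :
    ∃ p : Fin m × Fin m, g.1 p.1 p.2 ≠ 0 := by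
  by_contra! h
  have h0 : g.1 = 0 := by
    ext i j
    exact h (i, j)
  have := (isUnits_det_units g).ne_zero
  have hne : Nonempty (Fin m) := ⟨⟨0, hm⟩⟩
  exact this (by rw [h0, det_zero])

/-- The orbits have dimension at most `∑ aⱼ² - (|J| - 1)`. -/
theorem not_kronPrehomogeneous_of_lt {a : J → ℕ} (ha : ∀ j, 1 ≤ a j) (j₀ : J)
    (h : ∑ j, a j ^ 2 + 1 < ∏ j, a j + Fintype.card J) : ¬ KronPrehomogeneous a := by
  rintro ⟨v, hv⟩
  let K := ∀ j, Fin (a j) × Fin (a j)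
  -- A chart `k` selects one entry in each factor. Away from `j₀` that entry is normalised to 1 and
  -- is not a coordinate, which saves `|J| - 1` parameters.
  let P : K → (Σ j : J, Fin (a j) × Fin (a j)) → Prop := fun k x => x.1 = j₀ ∨ x.2 ≠ k x.1
  let M : ∀ k : K, ({x // P k x} → ℂ) → ∀ j, Matrix (Fin (a j)) (Fin (a j)) ℂ := fun k y j =>
    Matrix.of fun r c => if hx : P k ⟨j, (r, c)⟩ then y ⟨_, hx⟩ else 1
  have hM : ∀ k, PolyMap (fun y => kron (M k y) *ᵥ v) := by
    intro k
    refine PolyMap.pi fun r => PolyMap.sum fun c _ => PolyMap.mul ?_ (PolyMap.const _)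
    refine PolyMap.prod fun (j : J) _ => ?_
    by_cases hx : P k ⟨j, (r j, c j)⟩
    · simpa [M, hx] using (PolyMap.id (V := {x // P k x} → ℂ)).apply (E := fun _ => ℂ)
        ⟨⟨j, (r j, c j)⟩, hx⟩
    · simpa [M, hx] using PolyMap.const (1 : ℂ)
  refine not_zDense_of_card_lt (K := K) (σ := fun k => {x // P k x}) ?_
    (fun k y => kron (M k y) *ᵥ v) hM ?_ hv
  · intro k
    have h1 := Fintype.card_subtype_compl (P k)
    have h2 : Fintype.card {j // j ≠ j₀} ≤ Fintype.card {x // ¬ P k x} := by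
      refine Fintype.card_le_of_injective (fun j => ⟨⟨j.1, k j.1⟩, ?_⟩) ?_
      · simpa [P] using j.2
      · intro i j hij
        have := congrArg (fun x => x.1.1) hij
        exact Subtype.ext this
    have h3 : Fintype.card {j // j ≠ j₀} = Fintype.card J - 1 := by
      simp
    have h4 : Fintype.card (Σ j, Fin (a j) × Fin (a j)) = ∑ j, a j ^ 2 := by
      simp [sq]
    have h5 : Fintype.card (∀ j, Fin (a j)) = ∏ j, a j := by simp
    have h6 : 0 < Fintype.card J := Fintype.card_pos_iff.2 ⟨j₀⟩
    have h7 := Fintype.card_subtype_le (P k)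
    rw [h5]
    omega
  · rintro _ ⟨g, rfl⟩
    choose k hk using fun j => exists_entry_ne_zero (ha j) (g j)
    let c : J → ℂ := fun j => (g j).1 (k j).1 (k j).2
    -- Rescaling by `d` normalises the selected entries away from `j₀`. The factor at `j₀`
    -- compensates, so the Kronecker product does not change.
    let d : J → ℂ := fun j => if j = j₀ then ∏ i ∈ Finset.univ.erase j₀, c i else (c j)⁻¹
    have hd : ∏ j, d j = 1 := by
      rw [← Finset.mul_prod_erase _ _ (Finset.mem_univ j₀)]
      have h1 : ∏ j ∈ Finset.univ.erase j₀, d j = ∏ j ∈ Finset.univ.erase j₀, (c j)⁻¹ :=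
        Finset.prod_congr rfl fun j hj => if_neg (Finset.ne_of_mem_erase hj)
      rw [h1, Finset.prod_inv_distrib]
      simp only [d, if_true]
      exact mul_inv_cancel₀ (Finset.prod_ne_zero_iff.2 fun j _ => hk j)
    refine ⟨k, fun x => d x.1.1 * (g x.1.1).1 x.1.2.1 x.1.2.2, ?_⟩
    have h1 : M k (fun x => d x.1.1 * (g x.1.1).1 x.1.2.1 x.1.2.2) = fun j => d j • (g j).1 := by
      funext j
      ext r s
      by_cases hx : P k ⟨j, (r, s)⟩
      · simp [M, hx]
      · have hx' := hx
        simp only [P, not_or, not_not] at hx'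
        obtain ⟨hj, hrs⟩ := hx'
        have h3 : (g j).1 r s = c j := by
          simp only [c, ← hrs]
        simp only [M, hx, Matrix.of_apply, dif_neg, not_false_eq_true, Matrix.smul_apply,
          smul_eq_mul, d, if_neg hj, h3]
        exact (inv_mul_cancel₀ (hk j)).symm
    rw [h1, kron_smul, hd, one_smul]
    rfl

end Dimension

/-! ### Pencils of square matrices -/

section Pencils

theorem PolyMap.exists_polynomial {f : ℂ → ℂ} (hf : PolyMap f) :
    ∃ p : Polynomial ℂ, ∀ x, f x = p.eval x := by
  rw [polyMap_iff_mem] at hf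
  induction hf using Algebra.adjoin_induction with
  | mem x hx =>
    obtain ⟨ψ, rfl⟩ := hx
    refine ⟨Polynomial.C (ψ 1) * Polynomial.X, fun x => ?_⟩
    have := ψ.map_smul x 1
    simp only [smul_eq_mul, mul_one] at this
    rw [Polynomial.eval_mul, Polynomial.eval_C, Polynomial.eval_X, mul_comm]
    exact this
  | algebraMap r => exact ⟨Polynomial.C r, fun x => by simp⟩
  | add x y _ _ hx hy =>
    obtain ⟨p, hp⟩ := hx
    obtain ⟨q, hq⟩ := hy
    exact ⟨p + q, fun x => by simp [hp, hq]⟩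
  | mul x y _ _ hx hy =>
    obtain ⟨p, hp⟩ := hx
    obtain ⟨q, hq⟩ := hy
    exact ⟨p * q, fun x => by simp [hp, hq]⟩

open Topology in
-- On each line through `v` the polynomial has infinitely many zeros near `v`, so it vanishes on the
-- whole line.
theorem zDense_of_mem_nhds {F : Type*} [AddCommGroup F] [Module ℂ F] [TopologicalSpace F]
    [ContinuousAdd F] [ContinuousSMul ℂ F] {S : Set F} {v : F} (hS : S ∈ 𝓝 v) : ZDense S := by
  intro f hf h w
  have hline : PolyMap (fun t : ℂ => v + t • (w - v)) :=
    (PolyMap.const v).add (PolyMap.of_linear (LinearMap.toSpanSingleton ℂ F (w - v)))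
  obtain ⟨p, hp⟩ := (hf.comp hline).exists_polynomial
  have hcont : Continuous (fun t : ℂ => v + t • (w - v)) := by fun_prop
  have hnhds : (fun t : ℂ => v + t • (w - v)) ⁻¹' S ∈ 𝓝 (0 : ℂ) := by
    apply hcont.continuousAt.preimage_mem_nhds
    simpa using hS
  have hinf := infinite_of_mem_nhds (0 : ℂ) hnhds
  have hp0 : p = 0 := Polynomial.eq_zero_of_infinite_isRoot p
    (hinf.mono fun t ht => by
      rw [Set.mem_ofPred_eq, Polynomial.IsRoot, ← hp]
      exact h _ ht)
  have := hp 1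
  simpa [hp0] using this

/-- The space of pencils of `k × k` matrices is prehomogeneous. -/
def PencilPrehomogeneous (k : ℕ) : Prop :=
  ∃ V : Fin 2 → Matrix (Fin k) (Fin k) ℂ,
    ZDense {W | ∃ (x : Matrix (Fin 2) (Fin 2) ℂ) (y z : Matrix (Fin k) (Fin k) ℂ),
      x.det ≠ 0 ∧ y.det ≠ 0 ∧ z.det ≠ 0 ∧ W = fun s => y * (∑ t, x s t • V t) * z}

theorem kronPrehomogeneous_pencil (k : ℕ) :
    KronPrehomogeneous ![2, k, k] ↔ PencilPrehomogeneous k := by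
  rw [kronPrehomogeneous_fin_three]
  constructor
  · rintro ⟨V, hV⟩
    refine ⟨V, hV.mono ?_⟩
    rintro _ ⟨x, y, z, hx, hy, hz, rfl⟩
    exact ⟨x, y, z, hx, hy, hz, rfl⟩
  · rintro ⟨V, hV⟩
    refine ⟨V, hV.mono ?_⟩
    rintro _ ⟨x, y, z, hx, hy, hz, rfl⟩
    exact ⟨x, y, z, hx, hy, hz, rfl⟩

open Polynomial in
-- Roots over `ℂ` give the linear factors, and constant factors (roots at infinity) make up the
-- missing degree. The product is the determinant of a diagonal pencil.
theorem exists_linear_factors (k : ℕ) (hk : 1 ≤ k) (p : ℂ[X]) (hp : p.natDegree ≤ k) :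
    ∃ α β : Fin k → ℂ, ∀ s, p.eval s = ∏ i, (α i + s * β i) := by
  induction k, hk using Nat.le_induction generalizing p with
  | base =>
    refine ⟨fun _ => p.coeff 0, fun _ => p.coeff 1, fun s => ?_⟩
    rw [p.eval_eq_sum_range' (n := 2) (by omega)]
    simp [Finset.sum_range_succ, mul_comm]
  | succ k hk ih =>
    by_cases h0 : p.natDegree = 0
    · obtain ⟨α, β, h⟩ := ih p (by omega)
      refine ⟨Fin.cons 1 α, Fin.cons 0 β, fun s => ?_⟩
      simp [Fin.prod_univ_succ, h s]
    · obtain ⟨r, hr⟩ := IsAlgClosed.exists_root p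
        (fun hd => h0 (natDegree_eq_of_degree_eq_some hd))
      obtain ⟨q, rfl⟩ := dvd_iff_isRoot.2 hr
      have hq : q ≠ 0 := by
        rintro rfl
        simp at h0
      rw [natDegree_mul (X_sub_C_ne_zero r) hq, natDegree_X_sub_C] at hp
      obtain ⟨α, β, h⟩ := ih q (by omega)
      refine ⟨Fin.cons (-r) α, Fin.cons 1 β, fun s => ?_⟩
      simp only [eval_mul, eval_sub, eval_X, eval_C, Fin.prod_univ_succ, Fin.cons_zero,
        Fin.cons_succ, h s]
      ring

/-- For `k ≥ 4`, the binary form `det (x A + y B)` of degree `k` has moduli. -/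
theorem not_pencilPrehomogeneous {k : ℕ} (hk : 4 ≤ k) : ¬ PencilPrehomogeneous k := by
  rintro ⟨V, hV⟩
  -- The form is sampled at five points. Since `4 ≤ k`, interpolation makes `D` surjective, while
  -- the image of an orbit depends on only the four entries of a `2 × 2` matrix.
  let D : (Fin 2 → Matrix (Fin k) (Fin k) ℂ) → Fin 5 → ℂ :=
    fun W s => (W 0 + ((s : ℕ) : ℂ) • W 1).det
  have hD : PolyMap D := by
    refine PolyMap.pi fun s => PolyMap.det (PolyMap.matrix fun i j => ?_)
    exact ((PolyMap.id.apply 0).entry i j).add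
      ((PolyMap.const _).mul ((PolyMap.id.apply 1).entry i j))
  have hsurj : Function.Surjective D := by
    intro c
    have hinj : Set.InjOn (fun s : Fin 5 => ((s : ℕ) : ℂ)) (Finset.univ : Finset (Fin 5)) :=
      fun s _ t _ hst => Fin.ext (Nat.cast_injective hst)
    let p := Lagrange.interpolate Finset.univ (fun s : Fin 5 => ((s : ℕ) : ℂ)) c
    have hdeg : p.natDegree ≤ k := by
      have h1 : p.degree < 5 := Lagrange.degree_interpolate_lt c hinj
      have h2 := Polynomial.natDegree_le_of_degree_le (n := 4)
        (Order.lt_succ_iff.1 (by exact_mod_cast h1))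
      omega
    obtain ⟨α, β, h⟩ := exists_linear_factors k (by omega) p hdeg
    refine ⟨![diagonal α, diagonal β], ?_⟩
    funext s
    simp only [D, cons_val_zero, cons_val_one]
    rw [← diagonal_smul, diagonal_add, det_diagonal]
    have h1 := h ((s : ℕ) : ℂ)
    rw [Lagrange.eval_interpolate_at_node c hinj (Finset.mem_univ s)] at h1
    rw [h1]
    rfl
  have hdense := hV.image hD hsurj
  refine not_zDense_of_card_lt (K := Unit) (τ := Fin 5) (σ := fun _ => Fin 2 × Fin 2) (by simp)
    (fun _ y s => (∑ t, (y (0, t) + ((s : ℕ) : ℂ) * y (1, t)) • V t).det) ?_ ?_ hdense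
  · intro _
    refine PolyMap.pi fun s => PolyMap.det (PolyMap.sum fun t _ => PolyMap.matrix fun i j => ?_)
    exact (((PolyMap.id.apply (0, t))).add
      ((PolyMap.const _).mul (PolyMap.id.apply (1, t)))).mul (PolyMap.const _)
  · rintro _ ⟨_, ⟨x, y, z, -, -, -, rfl⟩, rfl⟩
    -- The form has degree `k`, so a `k`-th root lets `x` absorb both determinants.
    obtain ⟨μ, hμ⟩ := IsAlgClosed.exists_pow_nat_eq (y.det * z.det) (n := k) (by omega)
    refine ⟨(), fun p => μ * x p.1 p.2, ?_⟩
    funext s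
    have h1 : y * (∑ t, x 0 t • V t) * z + ((s : ℕ) : ℂ) • (y * (∑ t, x 1 t • V t) * z) =
        y * (∑ t, (x 0 t + ((s : ℕ) : ℂ) * x 1 t) • V t) * z := by
      simp only [add_smul, mul_smul, Finset.sum_add_distrib, ← Finset.smul_sum, Matrix.mul_add,
        Matrix.add_mul, Matrix.mul_smul, Matrix.smul_mul]
    have h2 : (∑ t, (μ * x 0 t + ((s : ℕ) : ℂ) * (μ * x 1 t)) • V t) =
        μ • ∑ t, (x 0 t + ((s : ℕ) : ℂ) * x 1 t) • V t := by
      rw [Finset.smul_sum]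
      refine Finset.sum_congr rfl fun t _ => ?_
      rw [smul_smul]
      congr 1
      ring
    simp only [D]
    rw [h1, h2, det_mul, det_mul, det_smul, Fintype.card_fin, hμ]
    ring

attribute [local instance] Matrix.linftyOpNormedRing Matrix.linftyOpNormedAlgebra

open Topology in
/-- A pencil whose tangent space to the orbit is everything has a dense orbit. -/
theorem pencilPrehomogeneous_of_tangent {k : ℕ} (V : Fin 2 → Matrix (Fin k) (Fin k) ℂ)
    (hV : ∀ W : Fin 2 → Matrix (Fin k) (Fin k) ℂ, ∃ (x : Matrix (Fin 2) (Fin 2) ℂ)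
      (y z : Matrix (Fin k) (Fin k) ℂ), ∀ s, y * V s + ∑ t, x s t • V t + V s * z = W s) :
    PencilPrehomogeneous k := by
  let E := Matrix (Fin 2) (Fin 2) ℂ × Matrix (Fin k) (Fin k) ℂ × Matrix (Fin k) (Fin k) ℂ
  let A : Fin 2 → E →L[ℂ] Matrix (Fin k) (Fin k) ℂ := fun s => LinearMap.toContinuousLinearMap
    ((∑ t, (Matrix.entryLinearMap ℂ ℂ s t).smulRight (V t)) ∘ₗ LinearMap.fst ℂ _ _)
  have hA : ∀ s (u : E), A s u = ∑ t, u.1 s t • V t := fun s u => by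
    simp only [A, LinearMap.coe_toContinuousLinearMap', LinearMap.comp_apply,
      LinearMap.sum_apply, LinearMap.smulRight_apply, Matrix.entryLinearMap_apply]
    rfl
  let Y : E →L[ℂ] Matrix (Fin k) (Fin k) ℂ :=
    (ContinuousLinearMap.fst ℂ _ _).comp (ContinuousLinearMap.snd ℂ _ _)
  let Z : E →L[ℂ] Matrix (Fin k) (Fin k) ℂ :=
    (ContinuousLinearMap.snd ℂ _ _).comp (ContinuousLinearMap.snd ℂ _ _)
  have hY : ∀ u : E, Y u = u.2.1 := fun _ => rfl
  have hZ : ∀ u : E, Z u = u.2.2 := fun _ => rfl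
  let f : E → Fin 2 → Matrix (Fin k) (Fin k) ℂ := fun u s => Y u * A s u * Z u
  have hf := fun (e : E) => hasStrictFDerivAt_pi.2 fun s =>
    ((Y.hasStrictFDerivAt (x := e)).mul' (A s).hasStrictFDerivAt).mul' Z.hasStrictFDerivAt
  have hf1 := hf (1, 1, 1)
  -- A surjective strict derivative at the identity makes the orbit map open there; invertibility
  -- persists near the identity.
  have hmap := hf1.map_nhds_eq_of_surj ?_
  · refine ⟨V, zDense_of_mem_nhds (v := f (1, 1, 1)) ?_⟩
    have hmap' : Filter.map f (𝓝 (1, 1, 1)) = 𝓝 (f (1, 1, 1)) := hmap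
    rw [← hmap', Filter.mem_map]
    have hc1 : Continuous fun u : E => u.1.det := continuous_fst.matrix_det
    have hc2 : Continuous fun u : E => u.2.1.det := (continuous_fst.comp continuous_snd).matrix_det
    have hc3 : Continuous fun u : E => u.2.2.det := (continuous_snd.comp continuous_snd).matrix_det
    filter_upwards [hc1.continuousAt.eventually_ne (x := (1, 1, 1)) (y := 0) (by simp),
      hc2.continuousAt.eventually_ne (x := (1, 1, 1)) (y := 0) (by simp),
      hc3.continuousAt.eventually_ne (x := (1, 1, 1)) (y := 0) (by simp)] with u h1 h2 h3
    refine ⟨u.1, u.2.1, u.2.2, h1, h2, h3, ?_⟩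
    funext s
    simp only [f, hA, hY, hZ]
  · rw [LinearMap.range_eq_top]
    intro W
    obtain ⟨x, y, z, h⟩ := hV W
    refine ⟨(x, y, z), ?_⟩
    funext s
    rw [← h s]
    have hA1 : A s ((1 : Matrix (Fin 2) (Fin 2) ℂ), 1, 1) = V s := by
      rw [hA]
      simp [Matrix.one_apply]
    change Y (1, 1, 1) * A s (1, 1, 1) * Z (x, y, z) + (Y (1, 1, 1) * A s (x, y, z) +
      Y (x, y, z) * A s (1, 1, 1)) * Z (1, 1, 1) = _
    rw [hA1, hA, hY, hY, hZ, hZ]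
    simp only [Matrix.one_mul, Matrix.mul_one]
    abel

theorem pencilPrehomogeneous_two : PencilPrehomogeneous 2 := by
  refine pencilPrehomogeneous_of_tangent ![!![1, 0; 0, 0], !![0, 0; 0, 1]] fun W => ?_
  refine ⟨!![0, W 0 1 1; W 1 0 0, 0], !![W 0 0 0, W 1 0 1; W 0 1 0, W 1 1 1],
    !![0, W 0 0 1; W 1 1 0, 0], fun s => ?_⟩
  ext i j
  fin_cases s <;> fin_cases i <;> fin_cases j <;>
    simp [Fin.sum_univ_succ]

/-- The chosen pencil is `diag(s, t, s + t)`, with three distinct roots. Each off-diagonal position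
is a solvable `2 × 2` system in the entries of `y` and `z`; on the diagonal, `y` and `x` suffice. -/
theorem pencilPrehomogeneous_three : PencilPrehomogeneous 3 := by
  refine pencilPrehomogeneous_of_tangent
    ![!![1, 0, 0; 0, 0, 0; 0, 0, 1], !![0, 0, 0; 0, 1, 0; 0, 0, 1]] fun W => ?_
  refine ⟨!![W 0 2 2 - W 0 1 1 - (W 1 2 2 - W 1 0 0), W 0 1 1; W 1 0 0, 0],
    !![W 0 0 0 - (W 0 2 2 - W 0 1 1 - (W 1 2 2 - W 1 0 0)), W 1 0 1, W 1 0 2;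
      W 0 1 0, W 1 1 1, W 0 1 2;
      W 0 2 0 - W 1 2 0, W 1 2 1 - W 0 2 1, W 1 2 2 - W 1 0 0],
    !![0, W 0 0 1, W 0 0 2 - W 1 0 2;
      W 1 1 0, 0, W 1 1 2 - W 0 1 2;
      W 1 2 0, W 0 2 1, 0], fun s => ?_⟩
  ext i j
  fin_cases s <;> fin_cases i <;> fin_cases j <;>
    simp [Fin.sum_univ_succ] <;> ring

end Pencils

end TensorCastling

namespace TensorCastling

/-! ### Combinatorics of castling reduction -/

section Multisets

/-- The `N`-invariant of a multiset. -/
def multisetN (s : Multiset ℕ) : ℤ :=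
  (s.map fun x : ℕ => (x : ℤ) ^ 2 - 1).sum - ((s.prod : ℕ) : ℤ) + 1

/-- A castling transform replacing an entry by a strictly smaller positive one. -/
def CastlingDown (s s' : Multiset ℕ) : Prop :=
  ∃ x t, s = x ::ₘ t ∧ x < t.prod ∧ t.prod < 2 * x ∧ s' = (t.prod - x) ::ₘ t

theorem multisetN_cons (x : ℕ) (t : Multiset ℕ) :
    multisetN (x ::ₘ t) = (x : ℤ) ^ 2 - x * (t.prod : ℕ) + (t.map fun x : ℕ => (x : ℤ) ^ 2 - 1).sum := by
  simp only [multisetN, Multiset.map_cons, Multiset.sum_cons, Multiset.prod_cons, Nat.cast_mul]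
  ring

theorem multisetN_castling {x y : ℕ} {t : Multiset ℕ} (h : x + y = t.prod) :
    multisetN (x ::ₘ t) = multisetN (y ::ₘ t) := by
  rw [multisetN_cons, multisetN_cons, ← h]
  push_cast
  ring

/-- If two occurrences `x`, `y` could both be lowered and `r` is the product of the rest, then `y *
r < 2 * x` and `x * r < 2 * y` force `r < 2`. The lower bounds `x < y * r` and `y < x * r` exclude
that. -/
theorem CastlingDown.unique {s s₁ s₂ : Multiset ℕ} (h₁ : CastlingDown s s₁)
    (h₂ : CastlingDown s s₂) : s₁ = s₂ := by
  obtain ⟨x, t, rfl, hx1, hx2, rfl⟩ := h₁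
  obtain ⟨y, u, h, hy1, hy2, rfl⟩ := h₂
  rcases Multiset.cons_eq_cons.1 h with ⟨rfl, rfl⟩ | ⟨-, w, rfl, rfl⟩
  · rfl
  · exfalso
    rw [Multiset.prod_cons] at hx1 hx2 hy1 hy2
    generalize w.prod = r at *
    rcases Nat.lt_or_ge r 2 with hr | hr
    · interval_cases r <;> omega
    · have h1 : 2 * y ≤ y * r := by nlinarith
      have h2 : 2 * x ≤ x * r := by nlinarith
      omega

theorem CastlingDown.pos {s s' : Multiset ℕ} (h : CastlingDown s s') (hs : ∀ z ∈ s, 1 ≤ z) :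
    ∀ z ∈ s', 1 ≤ z := by
  obtain ⟨x, t, rfl, hx1, -, rfl⟩ := h
  intro z hz
  rcases Multiset.mem_cons.1 hz with rfl | hz
  · omega
  · exact hs z (Multiset.mem_cons_of_mem hz)

theorem CastlingDown.card {s s' : Multiset ℕ} (h : CastlingDown s s') : s'.card = s.card := by
  obtain ⟨x, t, rfl, -, -, rfl⟩ := h
  simp

theorem CastlingDown.multisetN_eq {s s' : Multiset ℕ} (h : CastlingDown s s') :
    multisetN s = multisetN s' := by
  obtain ⟨x, t, rfl, h1, -, rfl⟩ := h
  exact multisetN_castling (by omega)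

theorem CastlingDown.sum_lt {s s' : Multiset ℕ} (h : CastlingDown s s') : s'.sum < s.sum := by
  obtain ⟨x, t, rfl, h1, h2, rfl⟩ := h
  simp only [Multiset.sum_cons]
  omega

theorem CastlingDown.prod_le {s s' : Multiset ℕ} (h : CastlingDown s s') : s'.prod ≤ s.prod := by
  obtain ⟨x, t, rfl, h1, h2, rfl⟩ := h
  simp only [Multiset.prod_cons]
  exact Nat.mul_le_mul_right _ (by omega)

theorem prod_le_of_reflTransGen {s s' : Multiset ℕ}
    (h : Relation.ReflTransGen CastlingDown s s') : s'.prod ≤ s.prod := by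
  induction h with
  | refl => exact le_rfl
  | tail _ h ih => exact h.prod_le.trans ih

theorem exists_castlingDown_normalForm (s : Multiset ℕ) :
    ∃ s', Relation.ReflTransGen CastlingDown s s' ∧ ∀ s'', ¬ CastlingDown s' s'' := by
  induction h : s.sum using Nat.strong_induction_on generalizing s with
  | _ k ih =>
    by_cases hs : ∃ s'', CastlingDown s s''
    · obtain ⟨s'', hs''⟩ := hs
      obtain ⟨s', h1, h2⟩ := ih _ (h ▸ hs''.sum_lt) s'' rfl
      exact ⟨s', .head hs'' h1, h2⟩
    · exact ⟨s, .refl, fun s'' h => hs ⟨s'', h⟩⟩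

/-- Reaching a given irreducible multiset is invariant under castling. -/
theorem reflTransGen_castling_iff {T t : Multiset ℕ} {x y : ℕ} (hT : ∀ s, ¬ CastlingDown T s)
    (hx : 1 ≤ x) (hy : 1 ≤ y) (h : x + y = t.prod) :
    Relation.ReflTransGen CastlingDown (x ::ₘ t) T ↔
      Relation.ReflTransGen CastlingDown (y ::ₘ t) T := by
  have key : ∀ x y : ℕ, 1 ≤ y → x + y = t.prod → y < x →
      (Relation.ReflTransGen CastlingDown (x ::ₘ t) T ↔
        Relation.ReflTransGen CastlingDown (y ::ₘ t) T) := by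
    intro x y hy h hxy
    have hd : CastlingDown (x ::ₘ t) (y ::ₘ t) :=
      ⟨x, t, rfl, by omega, by omega, by rw [← h, Nat.add_sub_cancel_left]⟩
    refine ⟨fun hr => ?_, fun hr => .head hd hr⟩
    rcases hr.cases_head with rfl | ⟨c, hc, hr⟩
    · exact absurd hd (hT _)
    · rwa [← hc.unique hd]
  rcases lt_trichotomy x y with hxy | rfl | hxy
  · exact (key y x hx (by omega) hxy).symm
  · rfl
  · exact key x y hy h hxy

theorem exists_max_cons {s : Multiset ℕ} (hs : s ≠ 0) :
    ∃ x t, s = x ::ₘ t ∧ ∀ y ∈ t, y ≤ x := by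
  obtain ⟨x, hx, hmax⟩ := s.toFinset.exists_max_image id
    (by simpa [Finset.nonempty_iff_ne_empty] using hs)
  refine ⟨x, s.erase x, (Multiset.cons_erase (Multiset.mem_toFinset.1 hx)).symm, fun y hy => ?_⟩
  exact hmax y (Multiset.mem_toFinset.2 (Multiset.mem_of_mem_erase hy))

theorem sum_sq_sub_one_trichotomy {s : Multiset ℕ} (hs : ∀ z ∈ s, 1 ≤ z) :
    s = Multiset.replicate s.card 1 ∨ 3 ≤ (s.map fun x : ℕ => (x : ℤ) ^ 2 - 1).sum := by
  induction s using Multiset.induction_on with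
  | empty => simp
  | cons z s ih =>
    have hz := hs z (Multiset.mem_cons_self _ _)
    have hnn : 0 ≤ (s.map fun x : ℕ => (x : ℤ) ^ 2 - 1).sum := by
      refine Multiset.sum_nonneg fun c hc => ?_
      obtain ⟨x, hx, rfl⟩ := Multiset.mem_map.1 hc
      have : (1 : ℤ) ≤ x := by exact_mod_cast hs x (Multiset.mem_cons_of_mem hx)
      nlinarith
    rw [Multiset.map_cons, Multiset.sum_cons]
    rcases Nat.lt_or_ge z 2 with h2 | h2
    · obtain rfl : z = 1 := by omega
      rcases ih fun z hz => hs z (Multiset.mem_cons_of_mem hz) with h | h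
      · left
        rw [Multiset.card_cons, Multiset.replicate_succ, ← h]
      · right
        simpa using h
    · right
      have : (2 : ℤ) ≤ z := by exact_mod_cast h2
      nlinarith

/-- Here `N` is `x * (x - t.prod)`, which is nonnegative, plus the sum over `t`. That sum is at
least 3 unless `t` consists of ones; in that case `N = x * (x - 1)`, which skips 1. -/
theorem multisetN_dominant {x : ℕ} {t : Multiset ℕ} (hx : 1 ≤ x) (ht : ∀ z ∈ t, 1 ≤ z)
    (h : t.prod ≤ x) :
    multisetN (x ::ₘ t) = 0 ∨ (x = 2 ∧ t = Multiset.replicate t.card 1) ∨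
      3 ≤ multisetN (x ::ₘ t) := by
  rw [multisetN_cons]
  have h' : ((t.prod : ℕ) : ℤ) ≤ x := by exact_mod_cast h
  have hx' : (1 : ℤ) ≤ x := by exact_mod_cast hx
  rcases sum_sq_sub_one_trichotomy ht with h1 | h1
  · have hp : t.prod = 1 := by rw [h1]; simp
    have hs : (t.map fun x : ℕ => (x : ℤ) ^ 2 - 1).sum = 0 := by rw [h1]; simp
    rw [hp, hs]
    rcases Nat.lt_or_ge x 3 with h3 | h3
    · interval_cases x
      · left; norm_num
      · right; left; exact ⟨rfl, h1⟩
    · right; right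
      have : (3 : ℤ) ≤ x := by exact_mod_cast h3
      push_cast
      nlinarith
  · right; right
    nlinarith [mul_nonneg (by omega : (0 : ℤ) ≤ x) (sub_nonneg.2 h')]

/-- Meant for `w` the entries left after removing the two largest, `y` being the second largest. The
bound makes `N` negative in the generic case below. -/
theorem tail_trichotomy {y : ℕ} {w : Multiset ℕ} (hw : ∀ z ∈ w, 1 ≤ z ∧ z ≤ y) :
    w = Multiset.replicate w.card 1 ∨ (∃ r, w = 2 ::ₘ Multiset.replicate r 1) ∨
      (3 ≤ w.prod ∧ (w.map fun x : ℕ => (x : ℤ) ^ 2 - 1).sum ≤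
        (((w.prod : ℕ) : ℤ) - 2) * ((y : ℤ) ^ 2 - 1)) := by
  induction w using Multiset.induction_on with
  | empty => simp
  | cons z w ih =>
    obtain ⟨hz1, hzy⟩ := hw z (Multiset.mem_cons_self _ _)
    have ih := ih fun z hz => hw z (Multiset.mem_cons_of_mem hz)
    rcases Nat.lt_or_ge z 2 with h2 | h2
    · obtain rfl : z = 1 := by omega
      rcases ih with h | ⟨r, rfl⟩ | h
      · left
        rw [Multiset.card_cons, Multiset.replicate_succ, ← h]
      · right; left
        exact ⟨r + 1, by rw [Multiset.replicate_succ, Multiset.cons_swap]⟩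
      · right; right
        simpa using h
    · have hz' : (2 : ℤ) ≤ z := by exact_mod_cast h2
      have hzy' : (z : ℤ) ≤ y := by exact_mod_cast hzy
      have hL : (z : ℤ) ^ 2 - 1 ≤ (y : ℤ) ^ 2 - 1 := by nlinarith
      have hL0 : (0 : ℤ) ≤ (y : ℤ) ^ 2 - 1 := by nlinarith
      rw [Multiset.map_cons, Multiset.sum_cons, Multiset.prod_cons]
      rcases ih with h | ⟨r, rfl⟩ | ⟨h3, h⟩
      · have hp : w.prod = 1 := by rw [h]; simp
        have hs : (w.map fun x : ℕ => (x : ℤ) ^ 2 - 1).sum = 0 := by rw [h]; simp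
        rw [hp, hs]
        rcases Nat.lt_or_ge z 3 with h3 | h3
        · obtain rfl : z = 2 := by omega
          right; left
          exact ⟨w.card, by rw [← h]⟩
        · right; right
          refine ⟨by omega, ?_⟩
          have : (3 : ℤ) ≤ z := by exact_mod_cast h3
          push_cast
          nlinarith [mul_nonneg (sub_nonneg.2 this) hL0]
      · right; right
        simp only [Multiset.prod_cons, Multiset.prod_replicate, one_pow, Multiset.map_cons,
          Multiset.map_replicate, Multiset.sum_cons, Multiset.sum_replicate]
        refine ⟨by omega, ?_⟩
        push_cast
        have : (3 : ℤ) ≤ (y : ℤ) ^ 2 - 1 := by nlinarith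
        simp only [smul_zero]
        nlinarith
      · right; right
        refine ⟨by nlinarith, ?_⟩
        have h3' : (3 : ℤ) ≤ (w.prod : ℕ) := by exact_mod_cast h3
        rw [Nat.cast_mul]
        generalize ((w.prod : ℕ) : ℤ) = R at *
        have h4 : 0 ≤ ((z : ℤ) * R - R - 1) * ((y : ℤ) ^ 2 - 1) := mul_nonneg (by nlinarith) hL0
        linarith

/-- The multiset `{k, k, 2, 1, …, 1}`. -/
def kkTwo (r k : ℕ) : Multiset ℕ := k ::ₘ k ::ₘ 2 ::ₘ Multiset.replicate r 1

theorem prod_kkTwo (r k : ℕ) : (kkTwo r k).prod = 2 * k ^ 2 := by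
  simp [kkTwo]
  ring

theorem card_kkTwo (r k : ℕ) : (kkTwo r k).card = r + 3 := by
  simp [kkTwo]

theorem multisetN_kkTwo (r k : ℕ) : multisetN (kkTwo r k) = 2 := by
  simp [kkTwo, multisetN]
  ring

theorem kkTwo_pos {r k : ℕ} (hk : 1 ≤ k) : ∀ z ∈ kkTwo r k, 1 ≤ z := by
  intro z hz
  simp only [kkTwo, Multiset.mem_cons, Multiset.mem_replicate] at hz
  omega

/-- The entry `k` is a borderline case: the others have product `2 * k`, so castling fixes it. -/
theorem not_castlingDown_kkTwo (r k : ℕ) (s : Multiset ℕ) : ¬ CastlingDown (kkTwo r k) s := by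
  rintro ⟨x, t, h, h1, h2, -⟩
  have hx : x ∈ kkTwo r k := h ▸ Multiset.mem_cons_self _ _
  have hp : x * t.prod = 2 * k ^ 2 := by rw [← prod_kkTwo r k, h, Multiset.prod_cons]
  simp only [kkTwo, Multiset.mem_cons, Multiset.mem_replicate] at hx
  generalize t.prod = p at *
  rcases hx with rfl | rfl | rfl | ⟨-, rfl⟩
  · nlinarith
  · nlinarith
  · have : k < 2 := by nlinarith
    interval_cases k <;> omega
  · omega

/-- Classification of the irreducible multisets. -/
theorem irreducible_trichotomy {s : Multiset ℕ} (hs : s ≠ 0) (hpos : ∀ z ∈ s, 1 ≤ z)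
    (hirr : ∀ s', ¬ CastlingDown s s') :
    (∃ x t, s = x ::ₘ t ∧ t.prod ≤ x) ∨ (∃ r k, 2 ≤ k ∧ s = kkTwo r k) ∨ multisetN s ≤ -1 := by
  obtain ⟨x, t, rfl, hmax⟩ := exists_max_cons hs
  by_cases hdom : t.prod ≤ x
  · exact .inl ⟨x, t, rfl, hdom⟩
  right
  have hx := hpos x (Multiset.mem_cons_self _ _)
  have hred : 2 * x ≤ t.prod := by
    by_contra h
    exact hirr _ ⟨x, t, rfl, by omega, by omega, rfl⟩
  have ht : t ≠ 0 := by
    rintro rfl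
    simp only [Multiset.prod_zero] at hdom
    omega
  obtain ⟨y, w, rfl, hmax'⟩ := exists_max_cons ht
  have hyx := hmax y (Multiset.mem_cons_self _ _)
  have hy := hpos y (by simp)
  rw [Multiset.prod_cons] at hred
  rcases tail_trichotomy (y := y) (w := w)
    fun z hz => ⟨hpos z (by simp [hz]), hmax' z hz⟩ with h | ⟨r, rfl⟩ | ⟨h3, h⟩
  · have hp : w.prod = 1 := by rw [h]; simp
    rw [hp] at hred
    omega
  · left
    simp only [Multiset.prod_cons, Multiset.prod_replicate, one_pow, mul_one] at hred
    obtain rfl : x = y := by omega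
    have h2 := hmax' 2 (by simp)
    exact ⟨r, x, h2, rfl⟩
  · right
    rw [multisetN_cons, Multiset.prod_cons, Multiset.map_cons, Multiset.sum_cons]
    have h3' : (3 : ℤ) ≤ (w.prod : ℕ) := by exact_mod_cast h3
    have hred' : 2 * (x : ℤ) ≤ y * (w.prod : ℕ) := by exact_mod_cast hred
    have hyx' : (y : ℤ) ≤ x := by exact_mod_cast hyx
    have hy' : (1 : ℤ) ≤ y := by exact_mod_cast hy
    rw [Nat.cast_mul]
    generalize ((w.prod : ℕ) : ℤ) = R at *
    generalize (w.map fun x : ℕ => (x : ℤ) ^ 2 - 1).sum = W at *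
    generalize (x : ℤ) = X at *
    generalize (y : ℤ) = Y at *
    -- By `h`, `N ≤ X² - X * Y * R + (R - 1) * Y² - (R - 1)`. Half the sum of `e1` and `e2` shows
    -- that the first three terms total at most 0, so `N ≤ 1 - R ≤ -2`.
    have e1 : 0 ≤ (X - Y) * (Y * R - 2 * X) := mul_nonneg (by omega) (by omega)
    have e2 : 0 ≤ Y * (X - Y) * (R - 2) :=
      mul_nonneg (mul_nonneg (by omega) (by omega)) (by omega)
    nlinarith

end Multisets

end TensorCastling

namespace TensorCastling

/-! ### From multisets back to tuples and castling classes -/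

section Tuples

theorem exists_equiv_of_map_eq {J J' : Type} [Fintype J] [Fintype J'] {a : J → ℕ} {b : J' → ℕ}
    (h : Finset.univ.val.map a = Finset.univ.val.map b) : ∃ e : J ≃ J', ∀ j, b (e j) = a j := by
  have hcard : ∀ c, Fintype.card {j // a j = c} = Fintype.card {j // b j = c} := by
    intro c
    have h1 := congrArg (Multiset.count c) h
    rw [Multiset.count_map, Multiset.count_map] at h1
    rw [Fintype.card_subtype, Fintype.card_subtype, Finset.card_def, Finset.card_def,
      Finset.filter_val, Finset.filter_val]
    simpa only [eq_comm] using h1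
  exact ⟨Equiv.ofFiberEquiv fun c => Fintype.equivOfCardEq (hcard c),
    fun j => Equiv.ofFiberEquiv_map _ j⟩

/-- The multiset of entries of a tuple. -/
def entries {J : Type} [Fintype J] (a : J → ℕ) : Multiset ℕ := Finset.univ.val.map a

theorem exists_entries_eq {n : ℕ} {s : Multiset ℕ} (hs : s.card = n) :
    ∃ a : Fin n → ℕ, entries a = s := by
  subst hs
  induction s using Quotient.inductionOn with
  | _ l =>
    refine ⟨l.get, ?_⟩
    change Multiset.map l.get (Finset.univ : Finset (Fin l.length)).val = _
    rw [Fin.univ_val_map, List.ofFn_get]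
    rfl

theorem card_entries {n : ℕ} (a : Fin n → ℕ) : (entries a).card = n := by
  simp [entries]

theorem entries_pos_iff {n : ℕ} {a : Fin n → ℕ} :
    (∀ z ∈ entries a, 1 ≤ z) ↔ ∀ i, 1 ≤ a i := by
  simp [entries]

theorem prod_entries {n : ℕ} (a : Fin n → ℕ) : (entries a).prod = ∏ i, a i := rfl

theorem multisetN_entries {n : ℕ} (a : Fin n → ℕ) : multisetN (entries a) = tupleN a := by
  rw [multisetN, tupleN, prod_entries, entries, Multiset.map_map, Nat.cast_prod]
  change ∑ i, ((a i : ℤ) ^ 2 - 1) - _ + 1 = _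
  ring

theorem entries_eq_cons {J : Type} [Fintype J] [DecidableEq J] (a : J → ℕ) (i : J) :
    entries a = a i ::ₘ (Finset.univ.erase i).val.map a := by
  rw [entries, ← Finset.insert_erase (Finset.mem_univ i),
    Finset.insert_val_of_notMem (Finset.notMem_erase i _), Multiset.map_cons, Finset.erase_insert
    (Finset.notMem_erase i _)]

theorem entries_comp_equiv {J J' : Type} [Fintype J] [Fintype J'] (a : J' → ℕ) (e : J ≃ J') :
    entries (fun j => a (e j)) = entries a := by
  rw [entries, entries, ← Multiset.map_univ_val_equiv e, Multiset.map_map]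
  rfl

theorem entries_option {J : Type} [Fintype J] (m : ℕ) (a : J → ℕ) :
    entries (fun o : Option J => o.elim m a) = m ::ₘ entries a := by
  simp only [entries, univ_option, Finset.insertNone, OrderEmbedding.coe_ofMapLEIff,
    Finset.cons_val, Multiset.map_cons, Finset.map_val, Multiset.map_map]
  rfl

theorem entries_castSucc {m : ℕ} (a : Fin (m + 1) → ℕ) :
    entries a = a (Fin.last m) ::ₘ entries fun i : Fin m => a i.castSucc := by
  simp [entries, Fin.univ_castSuccEmb, Function.comp_def]

theorem entries_twoKK (m k : ℕ) : entries (twoKK (m + 3) k) = kkTwo m k := by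
  rw [entries_castSucc, entries_castSucc, entries_castSucc]
  have h : (fun i : Fin m => twoKK (m + 3) k i.castSucc.castSucc.castSucc) = fun _ => 1 := by
    funext i
    simp [twoKK]
  rw [h]
  simp [twoKK, kkTwo, entries]

/-- Prehomogeneity as a property of the multiset of entries. -/
def MultisetPrehomogeneous (s : Multiset ℕ) : Prop :=
  ∃ n, ∃ a : Fin n → ℕ, entries a = s ∧ KronPrehomogeneous a

theorem kronPrehomogeneous_iff_entries {J : Type} [Fintype J] [DecidableEq J] (a : J → ℕ) :
    KronPrehomogeneous a ↔ MultisetPrehomogeneous (entries a) := by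
  constructor
  · intro h
    let e := Fintype.equivFin J
    exact ⟨_, fun i => a (e.symm i), entries_comp_equiv a e.symm, h.comp_equiv e.symm⟩
  · rintro ⟨n, b, hb, h⟩
    obtain ⟨e, he⟩ := exists_equiv_of_map_eq hb.symm
    simpa only [he] using h.comp_equiv e

theorem isPrehomogeneousTuple_iff_entries {n : ℕ} (a : Fin n → ℕ) :
    IsPrehomogeneousTuple a ↔ MultisetPrehomogeneous (entries a) :=
  (isPrehomogeneousTuple_iff a).trans (kronPrehomogeneous_iff_entries a)

theorem MultisetPrehomogeneous.castling {x y : ℕ} {t : Multiset ℕ} (h : x + y = t.prod)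
    (hx : MultisetPrehomogeneous (x ::ₘ t)) : MultisetPrehomogeneous (y ::ₘ t) := by
  obtain ⟨n, hn⟩ : ∃ n, t.card = n := ⟨_, rfl⟩
  obtain ⟨a, rfl⟩ := exists_entries_eq hn
  rw [← entries_option, ← kronPrehomogeneous_iff_entries] at hx ⊢
  exact hx.castling_option h

theorem multisetPrehomogeneous_castling_iff {x y : ℕ} {t : Multiset ℕ} (h : x + y = t.prod) :
    MultisetPrehomogeneous (x ::ₘ t) ↔ MultisetPrehomogeneous (y ::ₘ t) :=
  ⟨fun hx => hx.castling h, fun hy => hy.castling (by rw [add_comm, h])⟩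

theorem multisetPrehomogeneous_of_prod_le {x : ℕ} {t : Multiset ℕ} (h : t.prod ≤ x) :
    MultisetPrehomogeneous (x ::ₘ t) := by
  obtain ⟨n, hn⟩ : ∃ n, t.card = n := ⟨_, rfl⟩
  obtain ⟨a, rfl⟩ := exists_entries_eq hn
  rw [← entries_option, ← kronPrehomogeneous_iff_entries]
  exact kronPrehomogeneous_option_of_le h

theorem multisetPrehomogeneous_one_cons {s : Multiset ℕ} (hs : s ≠ 0) :
    MultisetPrehomogeneous (1 ::ₘ s) ↔ MultisetPrehomogeneous s := by
  obtain ⟨a, ha⟩ := exists_entries_eq (rfl : s.card = s.card)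
  have : Nonempty (Fin s.card) := ⟨⟨0, Multiset.card_pos.2 hs⟩⟩
  rw [← ha, ← entries_option, ← kronPrehomogeneous_iff_entries, ← kronPrehomogeneous_iff_entries]
  exact kronPrehomogeneous_option_one a

theorem CastlingDown.prehomogeneous_iff {s s' : Multiset ℕ} (h : CastlingDown s s') :
    MultisetPrehomogeneous s ↔ MultisetPrehomogeneous s' := by
  obtain ⟨x, t, rfl, h1, -, rfl⟩ := h
  exact multisetPrehomogeneous_castling_iff (by omega)

theorem multisetPrehomogeneous_kkTwo (r k : ℕ) :
    MultisetPrehomogeneous (kkTwo r k) ↔ PencilPrehomogeneous k := by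
  induction r with
  | zero =>
    rw [← kronPrehomogeneous_pencil, kronPrehomogeneous_iff_entries]
    have : entries ![2, k, k] = kkTwo 0 k := by
      rw [entries_castSucc, entries_castSucc, entries_castSucc]
      rfl
    rw [this]
  | succ r ih =>
    have : kkTwo (r + 1) k = 1 ::ₘ kkTwo r k := by
      simp only [kkTwo, Multiset.replicate_succ]
      rw [Multiset.cons_swap 2 1, Multiset.cons_swap k 1, Multiset.cons_swap k 1]
    rw [this, multisetPrehomogeneous_one_cons (s := kkTwo r k) Multiset.cons_ne_zero, ih]

theorem multisetPrehomogeneous_kkTwo_iff {r k : ℕ} (hk : 1 ≤ k) :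
    MultisetPrehomogeneous (kkTwo r k) ↔ k ≤ 3 := by
  constructor
  · intro h
    by_contra h4
    exact not_pencilPrehomogeneous (by omega) ((multisetPrehomogeneous_kkTwo r k).1 h)
  · intro h
    interval_cases k
    · have : kkTwo r 1 = 2 ::ₘ 1 ::ₘ 1 ::ₘ Multiset.replicate r 1 := by
        rw [kkTwo, Multiset.cons_swap 1 2, Multiset.cons_swap 1 2]
      rw [this]
      exact multisetPrehomogeneous_of_prod_le (by simp)
    · exact (multisetPrehomogeneous_kkTwo r 2).2 pencilPrehomogeneous_two
    · exact (multisetPrehomogeneous_kkTwo r 3).2 pencilPrehomogeneous_three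

/-- A castling transform of tuples, in terms of the entries. -/
theorem IsCastlingTransform.exists_entries {n : ℕ} (hn : 1 ≤ n) {a b : Fin n → ℕ}
    (h : IsCastlingTransform a b) :
    ∃ x y t, entries a = x ::ₘ t ∧ entries b = y ::ₘ t ∧ x + y = t.prod := by
  obtain ⟨σ, hσ⟩ := h
  let i : Fin n := ⟨n - 1, by omega⟩
  have hi : i.val + 1 = n := by
    simp only [i]
    omega
  refine ⟨a (σ i), b i, (Finset.univ.erase i).val.map fun j => a (σ j), ?_, ?_, ?_⟩
  · rw [← entries_comp_equiv a σ, entries_eq_cons _ i]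
  · rw [entries_eq_cons b i]
    congr 1
    refine Multiset.map_congr rfl fun j hj => (hσ j).1 ?_
    have hji : j ≠ i := Finset.ne_of_mem_erase (Finset.mem_def.2 hj)
    have : j.val ≠ i.val := fun h => hji (Fin.ext h)
    have := j.isLt
    omega
  · rw [add_comm]
    exact (hσ i).2 hi

theorem CastlingEquiv.trans {n : ℕ} {a b c : Fin n → ℕ} (h : CastlingEquiv a b)
    (h' : CastlingEquiv b c) : CastlingEquiv a c :=
  Relation.EqvGen.trans _ _ _ h h'

theorem CastlingEquiv.symm {n : ℕ} {a b : Fin n → ℕ} (h : CastlingEquiv a b) :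
    CastlingEquiv b a :=
  Relation.EqvGen.symm _ _ h

/-- A tuple of positive integers is castling equivalent to its permutations. -/
theorem castlingEquiv_of_entries_eq {n : ℕ} (hn : 2 ≤ n) {a b : Fin n → ℕ} (ha : ∀ i, 1 ≤ a i)
    (h : entries a = entries b) : CastlingEquiv a b := by
  obtain ⟨π, hπ⟩ := exists_equiv_of_map_eq h
  let l : Fin n := ⟨n - 1, by omega⟩
  have hne : Nonempty (Fin n) := ⟨l⟩
  -- Castling at the smallest entry keeps the result nonnegative. As `σ` is arbitrary in a
  -- transform, `a` and `b` have a common transform `c`; its last entry may be 0, which the relation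
  -- permits.
  obtain ⟨i₀, -, hmin⟩ := Finset.exists_min_image Finset.univ a ⟨l, Finset.mem_univ _⟩
  let σ : Equiv.Perm (Fin n) := Equiv.swap l i₀
  have hσ : σ l = i₀ := Equiv.swap_apply_left _ _
  let P := ∏ j ∈ Finset.univ.erase l, a (σ j)
  have hP : a i₀ ≤ P := by
    have hmem : (⟨0, by omega⟩ : Fin n) ∈ Finset.univ.erase l := by
      simp only [Finset.mem_erase, Finset.mem_univ, and_true, l, ne_eq, Fin.mk.injEq]
      omega
    refine (hmin (σ ⟨0, by omega⟩) (Finset.mem_univ _)).trans (Nat.le_of_dvd ?_ ?_)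
    · exact Finset.prod_pos fun j _ => ha _
    · exact Finset.dvd_prod_of_mem (fun j => a (σ j)) hmem
  let c : Fin n → ℕ := Function.update (fun j => a (σ j)) l (P - a i₀)
  have hcl : c l = P - a i₀ := Function.update_self _ _ _
  have hcne : ∀ i, i ≠ l → c i = a (σ i) := fun i hi => Function.update_of_ne hi _ _
  have hl : ∀ i : Fin n, i.val + 1 = n → i = l := fun i hi => Fin.ext (by simp only [l]; omega)
  have hl' : ∀ i : Fin n, i.val + 1 < n → i ≠ l := by
    rintro _ hi rfl
    simp only [l] at hi
    omega
  have key : ∀ (d : Fin n → ℕ) (τ : Equiv.Perm (Fin n)), (∀ j, d (τ j) = a (σ j)) →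
      IsCastlingTransform d c := by
    intro d τ hτ
    refine ⟨τ, fun i => ⟨fun hi => ?_, fun hi => ?_⟩⟩
    · rw [hτ, hcne i (hl' i hi)]
    · obtain rfl := hl i hi
      simp only [hτ]
      rw [hcl, hσ]
      exact Nat.sub_add_cancel hP
  have h1 : CastlingEquiv a c := .rel _ _ (key a σ fun _ => rfl)
  have h2 : CastlingEquiv b c := .rel _ _ (key b (σ.trans π) fun j => hπ _)
  exact h1.trans h2.symm

theorem exists_last_eq {n : ℕ} {a : Fin n → ℕ} {x : ℕ} {t : Multiset ℕ} (l : Fin n)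
    (h : entries a = x ::ₘ t) : ∃ a' : Fin n → ℕ, entries a' = entries a ∧ a' l = x := by
  have hx : x ∈ entries a := h ▸ Multiset.mem_cons_self _ _
  obtain ⟨i, -, rfl⟩ := Multiset.mem_map.1 hx
  exact ⟨fun j => a (Equiv.swap l i j), entries_comp_equiv a _, by simp⟩

theorem castlingEquiv_of_entries_castling {n : ℕ} (hn : 2 ≤ n) {a b : Fin n → ℕ}
    (ha : ∀ i, 1 ≤ a i) (hb : ∀ i, 1 ≤ b i) {x y : ℕ} {t : Multiset ℕ}
    (hxa : entries a = x ::ₘ t) (hyb : entries b = y ::ₘ t) (hxy : x + y = t.prod) :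
    CastlingEquiv a b := by
  let l : Fin n := ⟨n - 1, by omega⟩
  obtain ⟨a', ha', hl⟩ := exists_last_eq l hxa
  have ht : t = (Finset.univ.erase l).val.map a' := by
    have := entries_eq_cons a' l
    rw [ha', hxa, hl] at this
    exact (Multiset.cons_inj_right _).1 this
  let b' := Function.update a' l y
  have hbl : b' l = y := Function.update_self _ _ _
  have ht' : (Finset.univ.erase l).val.map b' = t := by
    rw [ht]
    refine Multiset.map_congr rfl fun j hj => ?_
    exact Function.update_of_ne (Finset.ne_of_mem_erase (Finset.mem_def.2 hj)) _ _
  have hb' : entries b' = entries b := by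
    rw [hyb, entries_eq_cons b' l, ht', hbl]
  have h1 : IsCastlingTransform a' b' := by
    refine ⟨1, fun i => ⟨fun hi => ?_, fun hi => ?_⟩⟩
    · refine Function.update_of_ne ?_ _ _
      rintro rfl
      simp only [l] at hi
      omega
    · obtain rfl : i = l := Fin.ext (by simp only [l]; omega)
      simp only [Equiv.Perm.coe_one, id_eq]
      rw [hbl, hl, add_comm, hxy, ht]
      rfl
  exact (castlingEquiv_of_entries_eq hn ha ha'.symm).trans
    ((Relation.EqvGen.rel _ _ h1).trans _ _ _ (castlingEquiv_of_entries_eq hn hb hb'.symm).symm)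

theorem exists_castlingEquiv_of_reflTransGen {n : ℕ} (hn : 2 ≤ n) {a : Fin n → ℕ}
    (ha : ∀ i, 1 ≤ a i) {s : Multiset ℕ}
    (h : Relation.ReflTransGen CastlingDown (entries a) s) :
    ∃ b : Fin n → ℕ, entries b = s ∧ (∀ i, 1 ≤ b i) ∧ CastlingEquiv a b := by
  induction h with
  | refl => exact ⟨a, rfl, ha, .refl _⟩
  | tail _ h ih =>
    obtain ⟨b, rfl, hb, hab⟩ := ih
    obtain ⟨c, rfl⟩ := exists_entries_eq (h.card.trans (card_entries b))
    have hc := entries_pos_iff.1 (h.pos (entries_pos_iff.2 hb))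
    refine ⟨c, rfl, hc, hab.trans ?_⟩
    obtain ⟨x, t, hx, h1, -, hy⟩ := h
    exact castlingEquiv_of_entries_castling hn hb hc hx hy (by omega)

/-- With a zero entry, `N` is the sum over `t`, which is 0 or at least 3. Castling a positive tuple
with `N = 2` therefore never produces a zero, and the reduction applies throughout its class. -/
theorem multisetN_zero_cons_ne_two {t : Multiset ℕ} (ht : ∀ z ∈ t, 1 ≤ z) :
    multisetN (0 ::ₘ t) ≠ 2 := by
  rw [multisetN_cons]
  rcases sum_sq_sub_one_trichotomy ht with h | h
  · rw [h]
    simp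
  · push_cast
    omega

/-- The invariants of a castling class with `N = 2`. -/
theorem CastlingEquiv.invariants {n : ℕ} (hn : 1 ≤ n) {T : Multiset ℕ}
    (hT : ∀ s, ¬ CastlingDown T s) {a b : Fin n → ℕ} (h : CastlingEquiv a b)
    (hN : multisetN (entries a) = 2) (ha : ∀ z ∈ entries a, 1 ≤ z) :
    (∀ z ∈ entries b, 1 ≤ z) ∧
    (Relation.ReflTransGen CastlingDown (entries a) T ↔
      Relation.ReflTransGen CastlingDown (entries b) T) ∧
    (MultisetPrehomogeneous (entries a) ↔ MultisetPrehomogeneous (entries b)) := by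
  -- A form symmetric in `a` and `b`, as needed for induction over the generated equivalence
  -- relation.
  suffices H : multisetN (entries a) = multisetN (entries b) ∧
      (multisetN (entries a) = 2 →
        ((∀ z ∈ entries a, 1 ≤ z) ↔ (∀ z ∈ entries b, 1 ≤ z)) ∧ ((∀ z ∈ entries a, 1 ≤ z) →
          (Relation.ReflTransGen CastlingDown (entries a) T ↔
            Relation.ReflTransGen CastlingDown (entries b) T))) ∧
      (MultisetPrehomogeneous (entries a) ↔ MultisetPrehomogeneous (entries b)) from
    ⟨((H.2.1 hN).1).1 ha, (H.2.1 hN).2 ha, H.2.2⟩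
  clear hN ha
  induction h with
  | rel a b h =>
    obtain ⟨x, y, t, hx, hy, hxy⟩ := h.exists_entries hn
    rw [hx, hy]
    refine ⟨multisetN_castling hxy, fun hN => ?_, multisetPrehomogeneous_castling_iff hxy⟩
    have hpos : ∀ x y : ℕ, multisetN (x ::ₘ t) = multisetN (y ::ₘ t) →
        multisetN (x ::ₘ t) = 2 → (∀ z ∈ x ::ₘ t, 1 ≤ z) → ∀ z ∈ y ::ₘ t, 1 ≤ z := by
      intro x y he hN h z hz
      have ht : ∀ z ∈ t, 1 ≤ z := fun z hz => h z (Multiset.mem_cons_of_mem hz)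
      rcases Multiset.mem_cons.1 hz with rfl | hz
      · by_contra h0
        obtain rfl : z = 0 := by omega
        exact multisetN_zero_cons_ne_two ht (he ▸ hN)
      · exact ht z hz
    have he := multisetN_castling hxy
    have h1 := hpos x y he hN
    refine ⟨⟨h1, hpos y x he.symm (he ▸ hN)⟩, fun ha => ?_⟩
    exact reflTransGen_castling_iff hT (ha x (Multiset.mem_cons_self _ _))
      (h1 ha y (Multiset.mem_cons_self _ _)) hxy
  | refl a => exact ⟨rfl, fun _ => ⟨Iff.rfl, fun _ => Iff.rfl⟩, Iff.rfl⟩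
  | symm a b _ ih =>
    obtain ⟨h1, h2, h3⟩ := ih
    refine ⟨h1.symm, fun hN => ?_, h3.symm⟩
    obtain ⟨h4, h5⟩ := h2 (h1.trans hN)
    exact ⟨h4.symm, fun hb => (h5 (h4.2 hb)).symm⟩
  | trans a b c _ _ ih ih' =>
    obtain ⟨h1, h2, h3⟩ := ih
    obtain ⟨h1', h2', h3'⟩ := ih'
    refine ⟨h1.trans h1', fun hN => ?_, h3.trans h3'⟩
    obtain ⟨h4, h5⟩ := h2 hN
    obtain ⟨h4', h5'⟩ := h2' (h1.symm.trans hN)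
    exact ⟨h4.trans h4', fun ha => (h5 ha).trans (h5' (h4.1 ha))⟩

/-- The castling normal form of a multiset of positive integers. -/
theorem normalForm_trichotomy {s : Multiset ℕ} (hcard : 3 ≤ s.card) (hpos : ∀ z ∈ s, 1 ≤ z) :
    (MultisetPrehomogeneous s ∧ (multisetN s = 0 ∨ 3 ≤ multisetN s)) ∨
    (multisetN s = 2 ∧ ∃ r k, 1 ≤ k ∧ Relation.ReflTransGen CastlingDown s (kkTwo r k)) ∨
    multisetN s ≤ -1 := by
  obtain ⟨s', hr, hirr⟩ := exists_castlingDown_normalForm s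
  obtain ⟨hc, hpos', hN, hpre⟩ : s'.card = s.card ∧ (∀ z ∈ s', 1 ≤ z) ∧
      multisetN s = multisetN s' ∧ (MultisetPrehomogeneous s ↔ MultisetPrehomogeneous s') := by
    clear hirr
    induction hr with
    | refl => exact ⟨rfl, hpos, rfl, Iff.rfl⟩
    | tail _ h ih =>
      obtain ⟨h1, h2, h3, h4⟩ := ih
      exact ⟨h.card.trans h1, h.pos h2, h3.trans h.multisetN_eq, h4.trans h.prehomogeneous_iff⟩
  have hs' : s' ≠ 0 := by
    rintro rfl
    simp only [Multiset.card_zero] at hc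
    omega
  rw [hN, hpre]
  rcases irreducible_trichotomy hs' hpos' hirr with ⟨x, t, rfl, h⟩ | ⟨r, k, hk, rfl⟩ | h
  · rcases multisetN_dominant (hpos' x (Multiset.mem_cons_self _ _))
      (fun z hz => hpos' z (Multiset.mem_cons_of_mem hz)) h with h0 | ⟨rfl, ht⟩ | h3
    · exact .inl ⟨multisetPrehomogeneous_of_prod_le h, .inl h0⟩
    · right; left
      obtain ⟨r, hr'⟩ : ∃ r, t.card = r + 2 := ⟨t.card - 2, by
        rw [Multiset.card_cons] at hc
        omega⟩
      -- The exceptional dominated multiset `{2, 1, …, 1}` is the case `k = 1` of the pencil family.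
      have hkk : 2 ::ₘ t = kkTwo r 1 := by
        rw [ht, hr', kkTwo, Multiset.replicate_succ, Multiset.replicate_succ,
          Multiset.cons_swap 1 2, Multiset.cons_swap 1 2]
      exact ⟨by rw [hkk, multisetN_kkTwo], r, 1, le_rfl, hkk ▸ hr⟩
    · exact .inl ⟨multisetPrehomogeneous_of_prod_le h, .inr h3⟩
  · exact .inr (.inl ⟨multisetN_kkTwo r k, r, k, by omega, hr⟩)
  · exact .inr (.inr h)

end Tuples

end TensorCastling

/-! ### The classification by `N` -/

theorem mainTheorem1 (n : ℕ) (hn : 3 ≤ n) (a : Fin n → ℕ) (ha : ∀ i, 1 ≤ a i) :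
    (TensorCastling.tupleN a ≤ -1 → ¬ TensorCastling.IsPrehomogeneousTuple a) ∧
    (TensorCastling.tupleN a = 0 ∨ TensorCastling.tupleN a = 1 →
      TensorCastling.IsPrehomogeneousTuple a) ∧
    (TensorCastling.tupleN a = 2 →
      ((4 ≤ n ∧ ∃ b : Fin n → ℕ, TensorCastling.IsMinimalTuple b ∧ (∀ i, 2 ≤ b i) ∧
          TensorCastling.CastlingEquiv a b) ∨
        (∃ k : ℕ, 1 ≤ k ∧ TensorCastling.IsMinimalTuple (TensorCastling.twoKK n k) ∧
          TensorCastling.CastlingEquiv a (TensorCastling.twoKK n k) ∧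
          ∀ k' : ℕ, 1 ≤ k' → TensorCastling.CastlingEquiv a (TensorCastling.twoKK n k') →
            k' = k)) ∧
      (∀ b : Fin n → ℕ, 4 ≤ n → TensorCastling.IsMinimalTuple b → (∀ i, 2 ≤ b i) →
        TensorCastling.CastlingEquiv a b → TensorCastling.IsPrehomogeneousTuple a) ∧
      (∀ k : ℕ, 1 ≤ k → TensorCastling.CastlingEquiv a (TensorCastling.twoKK n k) →
        (TensorCastling.IsPrehomogeneousTuple a ↔ k ≤ 3))) ∧
    (3 ≤ TensorCastling.tupleN a → TensorCastling.IsPrehomogeneousTuple a) ∧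
    (n = 3 → TensorCastling.tupleN a ≠ 1) := by
  open TensorCastling in
  have hpos := entries_pos_iff.2 ha
  have hcard := card_entries a
  have hcls := normalForm_trichotomy (by omega) hpos
  rw [multisetN_entries, ← isPrehomogeneousTuple_iff_entries] at hcls
  obtain ⟨m, rfl⟩ : ∃ m, n = m + 3 := ⟨n - 3, by omega⟩
  refine ⟨fun hN => ?_, fun hN => ?_, fun hN => ?_, fun hN => ?_, fun _ hN => ?_⟩
  · rw [isPrehomogeneousTuple_iff]
    refine not_kronPrehomogeneous_of_lt ha 0 ?_
    rw [tupleN, Finset.sum_sub_distrib] at hN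
    simp only [Finset.sum_const, Finset.card_univ, Fintype.card_fin, nsmul_eq_mul, mul_one] at hN
    rw [Fintype.card_fin]
    zify
    push_cast at hN
    linarith
  · rcases hcls with ⟨h, -⟩ | ⟨h, -⟩ | h
    · exact h
    · omega
    · omega
  · obtain ⟨k, hk, hred⟩ : ∃ k, 1 ≤ k ∧
        Relation.ReflTransGen CastlingDown (entries a) (kkTwo m k) := by
      rcases hcls with ⟨-, h⟩ | ⟨-, r, k, hk, h⟩ | h
      · omega
      · obtain ⟨b, hb, -, -⟩ := exists_castlingEquiv_of_reflTransGen (by omega) ha h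
        have := card_entries b
        rw [hb, card_kkTwo] at this
        obtain rfl : r = m := by omega
        exact ⟨k, hk, h⟩
      · omega
    have hNa : multisetN (entries a) = 2 := (multisetN_entries a).trans hN
    have huniq : ∀ k', 1 ≤ k' → CastlingEquiv a (twoKK (m + 3) k') → k' = k := by
      intro k' hk' h
      obtain ⟨-, h1, -⟩ := h.invariants (by omega) (not_castlingDown_kkTwo m k) hNa hpos
      have h2 := h1.1 hred
      rw [entries_twoKK] at h2
      rcases h2.cases_head with h3 | ⟨c, hc, -⟩
      · have h4 := congrArg Multiset.prod h3
        rw [prod_kkTwo, prod_kkTwo] at h4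
        exact Nat.pow_left_injective (n := 2) two_ne_zero (by simpa using h4)
      · exact absurd hc (not_castlingDown_kkTwo m k' c)
    -- The second alternative always holds. Minimality follows because every tuple of the class
    -- reduces to `kkTwo m k` by steps that do not increase the product.
    refine ⟨.inr ⟨k, hk, ⟨?_, ?_⟩, ?_, huniq⟩, ?_, ?_⟩
    · rw [← prod_entries, entries_twoKK, prod_kkTwo]
      positivity
    · intro b hb _
      obtain ⟨-, h1, -⟩ := hb.invariants (by omega) (not_castlingDown_kkTwo m k)
        (by rw [entries_twoKK, multisetN_kkTwo]) (by rw [entries_twoKK]; exact kkTwo_pos hk)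
      rw [entries_twoKK] at h1
      have h2 := prod_le_of_reflTransGen (h1.1 .refl)
      rwa [← prod_entries, ← prod_entries, entries_twoKK]
    · obtain ⟨b, hb, hbpos, hab⟩ := exists_castlingEquiv_of_reflTransGen (by omega) ha hred
      exact hab.trans (castlingEquiv_of_entries_eq (by omega) hbpos
        (hb.trans (entries_twoKK m k).symm))
    · intro b h4 hmin hb2 hab
      -- A minimal `b` must already be `kkTwo m k`, since a reduction step strictly lowers the
      -- positive product. For `n ≥ 4` that multiset contains 1, against `hb2`.
      exfalso
      obtain ⟨hbpos, h1, -⟩ := hab.invariants (by omega) (not_castlingDown_kkTwo m k) hNa hpos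
      have h2 := h1.1 hred
      rcases h2.cases_head with h3 | ⟨c, hc, -⟩
      · have hmem : 1 ∈ entries b := by
          rw [h3, kkTwo]
          simp only [Multiset.mem_cons, Multiset.mem_replicate]
          exact .inr (.inr (.inr ⟨by omega, trivial⟩))
        obtain ⟨i, -, hi⟩ := Multiset.mem_map.1 hmem
        have := hb2 i
        omega
      · obtain ⟨d, rfl, hd, hbd⟩ := exists_castlingEquiv_of_reflTransGen (by omega)
          (entries_pos_iff.1 hbpos) (.single hc)
        have h5 := hmin.2 d hbd (Finset.prod_pos fun i _ => hd i)
        obtain ⟨x, t, hx, hx1, hx2, hy⟩ := hc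
        rw [← prod_entries, ← prod_entries, hx, hy, Multiset.prod_cons, Multiset.prod_cons] at h5
        have h6 : 0 < t.prod := by omega
        have := Nat.le_of_mul_le_mul_right h5 h6
        omega
    · intro k' hk' h
      obtain ⟨-, -, h1⟩ := h.invariants (by omega) (not_castlingDown_kkTwo m k) hNa hpos
      rw [isPrehomogeneousTuple_iff_entries, h1, entries_twoKK,
        multisetPrehomogeneous_kkTwo_iff hk']
  · rcases hcls with ⟨h, -⟩ | ⟨h, -⟩ | h
    · exact h
    · omega
    · omega
  · rcases hcls with ⟨-, h⟩ | ⟨h, -⟩ | h <;> omega
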